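/- Let $\{(b_k,e_k)\}_{k\ge 0}$ be independent, identically distributed random vectors in $\mathbb R^2$, let $\varphi, X_0\in\mathbb R$ be constants, and let $$X_k=(\varphi+b_k)X_{k-1}+e_k,\qquad k\ge 1 .$$ Assume that $E\log^+|e_0|<\infty$ and $E\log^+|\varphi+b_0|<\infty$, that $Eb_0=0$, $Eb_0^2=\omega^2>0$, $Ee_0=0$, $Ee_0^2=\sigma^2>0$, $\operatorname{cov}(b_0,e_0)=0$, and that $E\log|\varphi+b_0|\ge 0$ (with $\log 0=-\infty$). For $\mathbf u=(s,x,y)$ with $x,y>0$ put $$L_n(\mathbf u)=-\frac12\sum_{k=1}^n\left(\log(xX_{k-1}^2+y)+\frac{(X_k-sX_{k-1})^2}{xX_{k-1}^2+y}\right),$$ $$f(s,x)=\frac12\left\{\log\frac{\omega^2}{x}+1-\frac{\omega^2}{x}-\frac{(\varphi-s)^2}{x}\right\},$$ and let $\boldsymbol\theta=(\varphi,\omega^2,\sigma^2)$. Then for every box $\Gamma^*=\{(s,x,y): s_*\le s\le s^*,\ x_*\le x\le x^*,\ y_*\le y\le y^*\}$ with $0<x_*$ and $0<y_*$, as $n\to\infty$,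 $$\sup_{\mathbf u\in\Gamma^*}\left|\frac1n\bigl(L_n(\mathbf u)-L_n(\boldsymbol\theta)\bigr)-f(s,x)\right|\overset{P}{\longrightarrow}0 .$$ The limit $f(s,x)$ does not depend on $y$; in particular, $$\sup_{(s,x,y)\in\Gamma^*,\ y_*\le y'\le y^*}\left|\frac1n\bigl(L_n(s,x,y)-L_n(s,x,y')\bigr)\right|\overset{P}{\longrightarrow}0 .$$ -/

import Mathlib

open MeasureTheory ProbabilityTheory Filter Topology
open scoped ENNReal

noncomputable section

namespace RCA

/-- The random coefficient autoregression started at the constant `x₀`: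
`X₀ = x₀` and `X_k = (φ + b_k) X_{k-1} + e_k` for `k ≥ 1`. -/
def process {Ω : Type*} (φ x₀ : ℝ) (b e : ℕ → Ω → ℝ) : ℕ → Ω → ℝ
  | 0, _ => x₀
  | k + 1, z => (φ + b (k + 1) z) * process φ x₀ b e k z + e (k + 1) z

/-- The `k`-th term (`k ≥ 1`) of the Gaussian conditional log-likelihood of a path `X`, without
constant terms, at the parameter `u = (s, x, y)`. -/
def logLikTerm (X : ℕ → ℝ) (k : ℕ) (u : ℝ × ℝ × ℝ) : ℝ :=
  -(1 / 2) * (Real.log (u.2.1 * X (k - 1) ^ 2 + u.2.2)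
    + (X k - u.1 * X (k - 1)) ^ 2 / (u.2.1 * X (k - 1) ^ 2 + u.2.2))

/-- The Gaussian quasi-log-likelihood `L_n(u) = ∑_{k=1}^n ℓ_k(u)` of a path `X`. -/
def logLik (X : ℕ → ℝ) (n : ℕ) (u : ℝ × ℝ × ℝ) : ℝ :=
  ∑ k ∈ Finset.Icc 1 n, logLikTerm X k u

/-- The limit function, with true parameters `φ` and `ωsq = ω²`. -/
def limitFun (φ ωsq s x : ℝ) : ℝ :=
  1 / 2 * (Real.log (ωsq / x) + 1 - ωsq / x - (φ - s) ^ 2 / x)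

/-- The parameter box of all `(s, x, y)` with `s ∈ [sl, su]`, `x ∈ [xl, xu]`, `y ∈ [yl, yu]`. -/
def paramBox (sl su xl xu yl yu : ℝ) : Set (ℝ × ℝ × ℝ) :=
  {u | (sl ≤ u.1 ∧ u.1 ≤ su) ∧ (xl ≤ u.2.1 ∧ u.2.1 ≤ xu) ∧ (yl ≤ u.2.2 ∧ u.2.2 ≤ yu)}

/-- `E log |Z| ≥ 0` for a random variable `Z` with `E log⁺ |Z| < ∞`, where `log 0 = -∞` and the
expectation takes values in `[-∞, ∞)`. Nonnegativity forces `Z ≠ 0` almost surely (`Real.log 0 = 0`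
is a convention only) and `log |Z|` to be integrable (the Bochner integral of a nonintegrable
function is `0` by convention only). -/
def LogMeanNonneg {Ω : Type*} [MeasurableSpace Ω] (P : Measure Ω) (Z : Ω → ℝ) : Prop :=
  (∀ᵐ z ∂P, Z z ≠ 0) ∧ Integrable (fun z => Real.log |Z z|) P ∧ 0 ≤ ∫ z, Real.log |Z z| ∂P

/-- `sup_{u ∈ Γ} |F_n(u)| → 0` in probability, for random functions `F_n` on a parameter space `U`.
The supremum is taken in `[0, ∞]`. -/
def UniformlyTendstoZeroInProb {Ω U : Type*} [MeasurableSpace Ω] (P : Measure Ω) (Γ : Set U)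
    (F : ℕ → Ω → U → ℝ) : Prop :=
  ∀ ε : ℝ, 0 < ε →
    Tendsto (fun n => P {z | ENNReal.ofReal ε < ⨆ u ∈ Γ, ENNReal.ofReal |F n z u|}) atTop (𝓝 0)

end RCA

end

/-! The residual at the true parameter is `b_k X_{k-1} + e_k`, so for large `|X_{k-1}|` a centered
likelihood term no longer feels the state or `y`. What remains is `f(s, x)` plus multiples of the
centered variables `b_k` and `b_k² - ω²`. The error is at most a constant times `(1 + b_k² + e_k²)
r(X_{k-1})`, where `r = decayWeight` vanishes at infinity (`abs_logLikTerm_sub_le`). The constants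
are uniform over the box, so the supremum is dominated by three time averages
(`exists_abs_logLik_sub_le`). Two of them tend to zero in `L¹` by the law of large numbers. In the
third, the innovation is independent of the past state, and only the Cesàro means of `E r(X_k)`
matter.

That these means vanish (`tendsto_cesaro_zero`) is proved by compactness, without a growth rate for
the process. Otherwise the averaged laws have a nonzero vague limit along an ultrafilter. Since `A =
φ + b₀` is almost surely nonzero, this limit is invariant, and normalizing it gives a stationary law
`π` of `y ↦ A y + B`, `B = e₀` (`exists_isStationary`).

No such law exists (`not_isStationary`). A point mass contradicts the moment conditions. For any
other `π`, the mass that an affine image of `π` puts outside `[-1, 1]` is harmonic under right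
composition with the random affine map, and the logarithm of the slope performs a random walk with
steps `log |A|`. An infimum over translations and large slopes yields a monotone superharmonic
function of the log-slope alone, and `ae_eq_zero_of_superharmonic` forces `log |A| = 0`; this
includes the critical case `E log |A| = 0`. Slopes `±1` are excluded by a second-order expansion of
the characteristic function at zero (`not_isStationary_of_abs_eq_one`). -/

noncomputable section

namespace RCA

/-! ### Superharmonic functions of a random walk -/

/-- A random walk with integrable steps of nonnegative mean that admits a nontrivial bounded
antitone superharmonic function, equal to `1` on the negative half-line and vanishing at `∞`,
has degenerate steps. -/
theorem ae_eq_zero_of_superharmonic {Ω : Type*} [MeasurableSpace Ω] {μ : Measure Ω}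
    [IsProbabilityMeasure μ] {X : Ω → ℝ} (hXm : Measurable X) (hX : Integrable X μ)
    (hmean : 0 ≤ ∫ w, X w ∂μ) {G : ℝ → ℝ} (hG : Antitone G) (hG0 : ∀ t, 0 ≤ G t)
    (hG1 : ∀ t, G t ≤ 1) (hneg : ∀ t < 0, G t = 1)
    (hsup : ∀ t, 0 ≤ t → ∫ w, G (t - X w) ∂μ ≤ G t)
    (hlim : Tendsto G atTop (𝓝 0)) : ∀ᵐ w ∂μ, X w = 0 := by
  have hGm : Measurable G := hG.measurable
  have hii : ∀ a b : ℝ, IntervalIntegrable G volume a b := fun a b => hG.intervalIntegrable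
  have hGX : ∀ t, Integrable (fun w => G (t - X w)) μ := fun t =>
    Integrable.of_bound (C := 1) (hGm.comp (measurable_const.sub hXm)).aestronglyMeasurable
      (Eventually.of_forall fun w => by
        rw [Real.norm_eq_abs, abs_of_nonneg (hG0 _)]; exact hG1 _)
  have hHanti : Antitone fun t => ∫ w, G (t - X w) ∂μ := fun s t hst =>
    integral_mono (hGX t) (hGX s) fun w => hG (by linarith)
  -- The defect of superharmonicity. It is nonnegative on the half-line, and its integral over `[0,
  -- T]` telescopes to two boundary terms.
  set D : ℝ → ℝ := fun t => G t - ∫ w, G (t - X w) ∂μ with hD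
  have hDi : ∀ a b : ℝ, IntervalIntegrable D volume a b := fun a b =>
    (hii a b).sub hHanti.intervalIntegrable
  have hcont : ∀ c, Continuous fun x => ∫ t in c..x, G t := fun c =>
    intervalIntegral.continuous_primitive hii c
  have habs : ∀ a b : ℝ, |∫ t in a..b, G t| ≤ |b - a| := by
    intro a b
    have := intervalIntegral.norm_integral_le_of_norm_le_const (a := a) (b := b) (f := G) (C := 1)
      (fun t _ => by rw [Real.norm_eq_abs, abs_of_nonneg (hG0 _)]; exact hG1 _)
    simpa using this
  have hJm : ∀ T, Measurable fun w => ∫ t in (T - X w)..T, G t := by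
    intro T
    have : (fun w => ∫ t in (T - X w)..T, G t) = fun w => -∫ t in T..(T - X w), G t := by
      ext w; rw [intervalIntegral.integral_symm]
    rw [this]
    exact ((hcont T).measurable.comp (measurable_const.sub hXm)).neg
  have hJi : ∀ T, Integrable (fun w => ∫ t in (T - X w)..T, G t) μ := fun T =>
    hX.mono (hJm T).aestronglyMeasurable (Eventually.of_forall fun w => by
      simpa using habs (T - X w) T)
  -- the integrated defect
  have key : ∀ T, 0 ≤ T → ∫ t in (0 : ℝ)..T, D t
      = ∫ w, (∫ t in (T - X w)..T, G t) ∂μ - ∫ w, (∫ t in (0 - X w)..0, G t) ∂μ := by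
    intro T hT
    have hsw : ∫ t in (0 : ℝ)..T, ∫ w, G (t - X w) ∂μ
        = ∫ w, (∫ t in (0 : ℝ)..T, G (t - X w)) ∂μ := by
      apply intervalIntegral_integral_swap
      have : IsFiniteMeasure ((volume : Measure ℝ).restrict (Set.uIoc 0 T)) :=
        ⟨by rw [Measure.restrict_apply_univ, Set.uIoc_of_le hT]; exact measure_Ioc_lt_top⟩
      refine Integrable.of_bound (C := 1) ?_ (Eventually.of_forall fun p => ?_)
      · exact (hGm.comp (measurable_fst.sub (hXm.comp measurable_snd))).aestronglyMeasurable
      · rw [Real.norm_eq_abs]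
        simp only [Function.uncurry]
        rw [abs_of_nonneg (hG0 _)]; exact hG1 _
    rw [hD, intervalIntegral.integral_sub (hii _ _) hHanti.intervalIntegrable, hsw,
      ← integral_sub (hJi T) (hJi 0)]
    have h1 : ∀ w, ∫ t in (0 : ℝ)..T, G (t - X w)
        = (∫ t in (0 : ℝ)..T, G t) - ((∫ t in (T - X w)..T, G t) - ∫ t in (0 - X w)..0, G t) := by
      intro w
      rw [intervalIntegral.integral_comp_sub_right]
      have e1 := intervalIntegral.integral_add_adjacent_intervals
        (hii (0 - X w) (T - X w)) (hii (T - X w) T)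
      have e2 := intervalIntegral.integral_add_adjacent_intervals
        (hii (0 - X w) 0) (hii 0 T)
      linarith
    simp_rw [h1]
    have h2 := integral_sub (μ := μ) (integrable_const (∫ t in (0 : ℝ)..T, G t))
      ((hJi T).sub (hJi 0))
    simp only [Pi.sub_apply] at h2
    rw [h2]
    simp
  -- The boundary term at `T` is at most `G(T - |X|) |X|`, hence vanishes by domination with `|X|`.
  have hJlim : Tendsto (fun T : ℝ => ∫ w, (∫ t in (T - X w)..T, G t) ∂μ) atTop (𝓝 0) := by
    have h0 : (0 : ℝ) = ∫ w : Ω, (0 : ℝ) ∂μ := by simp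
    rw [h0]
    refine tendsto_integral_filter_of_dominated_convergence (fun w => |X w|)
      (Eventually.of_forall fun T => (hJm T).aestronglyMeasurable)
      (Eventually.of_forall fun T => Eventually.of_forall fun w => by
        simpa using habs (T - X w) T) hX.abs (Eventually.of_forall fun w => ?_)
    have hb : ∀ T : ℝ, |∫ t in (T - X w)..T, G t| ≤ G (T - |X w|) * |X w| := by
      intro T
      have := intervalIntegral.norm_integral_le_of_norm_le_const (a := T - X w) (b := T) (f := G)
        (C := G (T - |X w|)) (fun t ht => by
          rw [Real.norm_eq_abs, abs_of_nonneg (hG0 _)]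
          apply hG
          have h1 := ht.1.le
          have h2 : T - |X w| ≤ min (T - X w) T :=
            le_min (by linarith [le_abs_self (X w)]) (by linarith [abs_nonneg (X w)])
          linarith)
      simpa using this
    refine squeeze_zero_norm hb ?_
    have := (hlim.comp (tendsto_atTop_add_const_right atTop (-|X w|) tendsto_id)).mul_const |X w|
    simpa [Function.comp_def, sub_eq_add_neg] using this
  have hDnn : ∀ t, 0 ≤ t → 0 ≤ D t := fun t ht => sub_nonneg.2 (hsup t ht)
  have hDmono : ∀ S T, 0 ≤ S → S ≤ T → ∫ t in (0 : ℝ)..S, D t ≤ ∫ t in (0 : ℝ)..T, D t := by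
    intro S T hS hST
    rw [← intervalIntegral.integral_add_adjacent_intervals (hDi 0 S) (hDi S T)]
    have := intervalIntegral.integral_nonneg hST (f := D) (μ := volume)
      (fun t ht => hDnn t (hS.trans ht.1))
    linarith
  -- Equality where `X ≥ 0`, since `G = 1` on the negative half-line; elsewhere it is the bound `G ≤
  -- 1`.
  have hJX : ∀ w, X w ≤ ∫ t in (0 - X w)..0, G t := by
    intro w
    rcases le_total 0 (X w) with h | h
    · have : ∫ t in (0 - X w)..0, G t = ∫ t in (0 - X w)..0, (1 : ℝ) := by
        apply intervalIntegral.integral_congr_ae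
        have hne : ∀ᵐ t : ℝ, t ≠ 0 := by
          simp [ae_iff]
        filter_upwards [hne] with t ht hmem
        rw [Set.uIoc_of_le (by linarith)] at hmem
        exact hneg t (lt_of_le_of_ne hmem.2 ht)
      rw [this]; simp
    · have := neg_abs_le (∫ t in (0 - X w)..0, G t)
      have h2 := habs (0 - X w) 0
      have h3 : |0 - (0 - X w)| = -X w := by
        rw [show 0 - (0 - X w) = X w by ring, abs_of_nonpos h]
      linarith
  -- Let the upper limit tend to infinity. With `hJX` the right side is at most `-E X ≤ 0`, so the
  -- integrated defect, `E X` and the gap in `hJX` must all vanish.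
  have hDle : ∀ S, 0 ≤ S → ∫ t in (0 : ℝ)..S, D t ≤ - ∫ w, (∫ t in (0 - X w)..0, G t) ∂μ := by
    intro S hS
    have hl : Tendsto (fun T : ℝ => ∫ w, (∫ t in (T - X w)..T, G t) ∂μ
        - ∫ w, (∫ t in (0 - X w)..0, G t) ∂μ) atTop
        (𝓝 (0 - ∫ w, (∫ t in (0 - X w)..0, G t) ∂μ)) := hJlim.sub_const _
    rw [zero_sub] at hl
    refine ge_of_tendsto hl ?_
    filter_upwards [eventually_ge_atTop S] with T hT
    rw [← key T (hS.trans hT)]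
    exact hDmono S T hS hT
  have hle : ∫ w, X w ∂μ ≤ ∫ w, (∫ t in (0 - X w)..0, G t) ∂μ :=
    integral_mono hX (hJi 0) hJX
  have hJ0 : ∫ w, (∫ t in (0 - X w)..0, G t) ∂μ = 0 := by
    have := hDle 0 le_rfl
    simp only [intervalIntegral.integral_same] at this
    linarith
  have hD0 : ∀ S, 0 ≤ S → ∫ t in (0 : ℝ)..S, D t = 0 := by
    intro S hS
    have h1 := hDle S hS
    rw [hJ0, neg_zero] at h1
    exact le_antisymm h1 (intervalIntegral.integral_nonneg hS fun t ht => hDnn t ht.1)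
  have hX0 : ∫ w, X w ∂μ = 0 := le_antisymm (hJ0 ▸ hle) hmean
  have hae : ∀ᵐ w ∂μ, (∫ t in (0 - X w)..0, G t) - X w = 0 := by
    have := (integral_eq_zero_iff_of_nonneg (μ := μ)
      (f := fun w => (∫ t in (0 - X w)..0, G t) - X w)
      (fun w => sub_nonneg.2 (hJX w)) ((hJi 0).sub hX)).1 (by
        rw [integral_sub (hJi 0) hX, hJ0, hX0, sub_zero])
    exact this
  have hpos : ∀ᵐ w ∂μ, 0 ≤ X w := by
    by_contra hcon
    have hex : ∃ δ : ℝ, 0 < δ ∧ μ {w | X w ≤ -δ} ≠ 0 := by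
      by_contra hno
      push Not at hno
      apply hcon
      have : ∀ n : ℕ, ∀ᵐ w ∂μ, ¬ X w ≤ -(1 / ((n : ℝ) + 1)) := by
        intro n
        rw [ae_iff]
        simpa using hno (1 / ((n : ℝ) + 1)) (by positivity)
      filter_upwards [ae_all_iff.2 this] with w hw
      by_contra hlt
      push Not at hlt
      obtain ⟨n, hn⟩ := exists_nat_one_div_lt (neg_pos.2 hlt)
      exact hw n (by linarith)
    obtain ⟨δ, hδ, hμδ⟩ := hex
    -- Equality in `hJX` at a single point with `X ≤ -δ` says that `G` has mean `1` over `[0, -X]`;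
    -- monotonicity and `G ≤ 1` do the rest.
    have hbase : ∀ t < δ, G t = 1 := by
      have : ∃ w, X w ≤ -δ ∧ (∫ t in (0 - X w)..0, G t) - X w = 0 := by
        by_contra hno
        push Not at hno
        apply hμδ
        have : ∀ᵐ w ∂μ, ¬ X w ≤ -δ := by
          filter_upwards [hae] with w hw h
          exact hno w h hw
        simpa [ae_iff] using this
      obtain ⟨w, hw, hw0⟩ := this
      intro t ht
      rcases lt_or_ge t 0 with h0 | h0
      · exact hneg t h0
      by_contra hne
      have hlt : G t < 1 := lt_of_le_of_ne (hG1 t) hne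
      have hsym : ∫ s in (0 - X w)..0, G s = -∫ s in (0 : ℝ)..(-X w), G s := by
        rw [zero_sub, intervalIntegral.integral_symm]
      have hsplit := intervalIntegral.integral_add_adjacent_intervals (hii 0 t) (hii t (-X w))
      have h1 : ∫ s in (0 : ℝ)..t, G s ≤ t := by
        have := habs 0 t
        rw [sub_zero, abs_of_nonneg h0] at this
        exact (le_abs_self _).trans this
      have h2 : ∫ s in t..(-X w), G s ≤ ∫ s in t..(-X w), G t :=
        intervalIntegral.integral_mono_on (by linarith) (hii _ _) (by simp)
          fun s hs => hG hs.1
      rw [intervalIntegral.integral_const, smul_eq_mul] at h2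
      have : 0 < (-X w - t) * (1 - G t) := mul_pos (by linarith) (by linarith)
      nlinarith
    -- For `s` between `t - δ` and `c`, a step `X ≤ -δ` carries `s` beyond `t`. If `G t < 1`, this
    -- makes the defect at `s` bounded below by a positive constant, against its zero integral.
    -- Iteration spreads `G = 1` over the whole line, contradicting the limit at infinity.
    have hstep : ∀ c, 0 < c → (∀ t < c, G t = 1) → ∀ t < c + δ, G t = 1 := by
      intro c hc hcG t ht
      by_contra hne
      have hlt : G t < 1 := lt_of_le_of_ne (hG1 t) hne
      set p := μ.real {w | X w ≤ -δ} with hp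
      have hp0 : 0 < p := by
        rw [hp, measureReal_def]
        exact ENNReal.toReal_pos hμδ (measure_ne_top _ _)
      have hms : MeasurableSet {w | X w ≤ -δ} := measurableSet_le hXm measurable_const
      set a := max (t - δ) 0 with ha
      have hac : a < c := max_lt (by linarith) hc
      have hDge : ∀ s ∈ Set.Icc a ((a + c) / 2), (1 - G t) * p ≤ D s := by
        intro s hs
        have hs1 : G s = 1 := hcG s (by linarith [hs.2])
        have hle : ∫ w, G (s - X w) ∂μ
            ≤ ∫ w, (1 - {w | X w ≤ -δ}.indicator (fun _ => 1 - G t) w) ∂μ := by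
          refine integral_mono (hGX s)
            ((integrable_const _).sub ((integrable_const _).indicator hms)) fun w => ?_
          by_cases hw : X w ≤ -δ
          · have : t ≤ s - X w := by linarith [hs.1, le_max_left (t - δ) 0]
            simp only [Set.indicator, Set.mem_ofPred_eq, hw, if_true]
            linarith [hG this]
          · simp only [Set.indicator, Set.mem_ofPred_eq, hw, if_false]
            linarith [hG1 (s - X w)]
        rw [integral_sub (integrable_const _) ((integrable_const _).indicator hms),
          integral_indicator_const _ hms] at hle
        simp only [integral_const, probReal_univ, smul_eq_mul] at hle
        simp only [hD]
        rw [hs1]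
        linarith [mul_comm p (1 - G t)]
      have ha0 : 0 ≤ a := le_max_right _ _
      have hm : ∫ s in a..((a + c) / 2), (1 - G t) * p ≤ ∫ s in a..((a + c) / 2), D s :=
        intervalIntegral.integral_mono_on (by linarith) (by simp) (hDi _ _) hDge
      rw [intervalIntegral.integral_const, smul_eq_mul] at hm
      have hsplit := intervalIntegral.integral_add_adjacent_intervals (hDi 0 a)
        (hDi a ((a + c) / 2))
      rw [hD0 a ha0, hD0 _ (by linarith)] at hsplit
      have : 0 < ((a + c) / 2 - a) * ((1 - G t) * p) :=
        mul_pos (by linarith) (mul_pos (by linarith) hp0)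
      linarith
    have hall : ∀ n : ℕ, ∀ t < ((n : ℝ) + 1) * δ, G t = 1 := by
      intro n
      induction n with
      | zero => simpa using hbase
      | succ n ih =>
        intro t ht
        refine hstep _ (by positivity) ih t ?_
        push_cast at ht
        linarith
    have hone : ∀ t, G t = 1 := by
      intro t
      obtain ⟨n, hn⟩ := exists_nat_gt (t / δ)
      exact hall n t (by rw [div_lt_iff₀ hδ] at hn; nlinarith)
    have : Tendsto G atTop (𝓝 1) := by
      simp [funext hone]
    exact zero_ne_one (tendsto_nhds_unique hlim this)
  exact (integral_eq_zero_iff_of_nonneg_ae hpos hX).1 hX0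

/-! ### Stationary laws of affine recursions and the walk of log-slopes -/

/-- `π` is a stationary law of the random affine recursion `y ↦ A y + B`, `(A, B) ∼ ν`. -/
def IsStationary (ν : Measure (ℝ × ℝ)) (π : Measure ℝ) : Prop :=
  (ν.prod π).map (fun p => p.1.1 * p.2 + p.1.2) = π

/-- The mass that the image of `π` under `y ↦ a y + z` puts outside `[-1, 1]`. -/
def tailMass (π : Measure ℝ) (a z : ℝ) : ℝ := π.real {y | 1 < |a * y + z|}

theorem measurableSet_tail (a z : ℝ) : MeasurableSet {y : ℝ | 1 < |a * y + z|} :=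
  measurableSet_lt measurable_const (by fun_prop)

theorem tailMass_nonneg {π : Measure ℝ} (a z : ℝ) : 0 ≤ tailMass π a z := measureReal_nonneg

section Stationary

variable {ν : Measure (ℝ × ℝ)} [IsProbabilityMeasure ν] {π : Measure ℝ} [IsProbabilityMeasure π]

theorem IsStationary.integral_eq (h : IsStationary ν π) {f : ℝ → ℝ} (hf : Measurable f) {C : ℝ}
    (hC : ∀ y, |f y| ≤ C) : ∫ y, f y ∂π = ∫ p, ∫ y, f (p.1 * y + p.2) ∂π ∂ν := by
  have hm : Measurable fun p : (ℝ × ℝ) × ℝ => p.1.1 * p.2 + p.1.2 := by fun_prop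
  have hi : Integrable (fun p : (ℝ × ℝ) × ℝ => f (p.1.1 * p.2 + p.1.2)) (ν.prod π) :=
    Integrable.of_bound (C := C) (hf.comp hm).aestronglyMeasurable
      (Eventually.of_forall fun p => hC _)
  conv_lhs => rw [← h]
  rw [integral_map hm.aemeasurable hf.aestronglyMeasurable, integral_prod _ hi]

/-- Replacing `y` by `A y + B` does not change the law `π` and turns the map `(a, z)` into `(aA, aB
+ z)`. Thus the tail mass is harmonic for a chain whose log-slope is a random walk. -/
theorem IsStationary.tailMass_eq (h : IsStationary ν π) (a z : ℝ) :
    tailMass π a z = ∫ p, tailMass π (a * p.1) (a * p.2 + z) ∂ν := by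
  have h1 := h.integral_eq (f := {y : ℝ | 1 < |a * y + z|}.indicator fun _ => 1)
    (measurable_const.indicator (measurableSet_tail a z)) (C := 1) (fun y => by
      by_cases hy : y ∈ {y : ℝ | 1 < |a * y + z|} <;> simp [hy])
  rw [integral_indicator_const _ (measurableSet_tail a z), smul_eq_mul, mul_one] at h1
  rw [tailMass, h1]
  congr 1
  ext p
  rw [tailMass, ← mul_one (π.real _), ← smul_eq_mul,
    ← integral_indicator_const _ (measurableSet_tail _ _)]
  congr 1
  ext y
  have : a * (p.1 * y + p.2) + z = a * p.1 * y + (a * p.2 + z) := by ring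
  simp only [Set.indicator, Set.mem_ofPred_eq, this]

theorem tailMass_le_one (a z : ℝ) : tailMass π a z ≤ 1 := measureReal_le_one

theorem measurable_tailMass : Measurable fun p : ℝ × ℝ => tailMass π p.1 p.2 := by
  have hs : MeasurableSet {q : (ℝ × ℝ) × ℝ | 1 < |q.1.1 * q.2 + q.1.2|} :=
    measurableSet_lt measurable_const (by fun_prop)
  exact (measurable_measure_prodMk_left (ν := π) hs).ennreal_toReal

theorem tendsto_tailMass_zero : Tendsto (fun a => tailMass π a 0) (𝓝 0) (𝓝 0) := by
  have h : ∀ a, tailMass π a 0 = ∫ y, {y : ℝ | 1 < |a * y + 0|}.indicator (fun _ => (1 : ℝ)) y ∂π := by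
    intro a
    rw [integral_indicator_const _ (measurableSet_tail a 0), smul_eq_mul, mul_one, tailMass]
  simp_rw [h]
  have h0 : (0 : ℝ) = ∫ y : ℝ, (0 : ℝ) ∂π := by simp
  conv => rhs; rw [h0]
  refine tendsto_integral_filter_of_dominated_convergence (fun _ => 1)
    (Eventually.of_forall fun a =>
      (measurable_const.indicator (measurableSet_tail a 0)).aestronglyMeasurable)
    (Eventually.of_forall fun a => Eventually.of_forall fun y => ?_) (integrable_const _)
    (Eventually.of_forall fun y => ?_)
  · by_cases hy : y ∈ {y : ℝ | 1 < |a * y + 0|} <;> simp only [Set.indicator, hy] <;> simp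
  · have hc : Tendsto (fun a : ℝ => |a * y + 0|) (𝓝 0) (𝓝 |0 * y + 0|) :=
      (Continuous.tendsto (by fun_prop) 0)
    have : ∀ᶠ a : ℝ in 𝓝 0, |a * y + 0| < 1 := hc.eventually_lt_const (by simp)
    refine tendsto_const_nhds.congr' ?_
    filter_upwards [this] with a ha
    simp only [Set.indicator, Set.mem_ofPred_eq, not_lt.2 ha.le, if_false]

/-- A law on the line that is not a point mass cannot be squeezed into `[-1, 1]` by affine maps of
large slope. -/
theorem exists_le_tailMass (hπ : ∀ c, π ≠ Measure.dirac c) :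
    ∃ K > 0, ∃ ε > 0, ∀ a z, K < |a| → ε ≤ tailMass π a z := by
  obtain ⟨p, hp, q, hq, hpq⟩ : ∃ p ∈ π.support, ∃ q ∈ π.support, p < q := by
    by_contra hno
    push Not at hno
    obtain ⟨c, hc⟩ := Measure.nonempty_support (IsProbabilityMeasure.ne_zero π)
    have hsub : π.support = {c} := by
      ext x
      exact ⟨fun hx => le_antisymm (hno c hc x hx) (hno x hx c hc), fun hx => hx ▸ hc⟩
    apply hπ c
    have hae : ∀ᵐ y ∂π, y = c := by
      have := Measure.support_mem_ae (μ := π)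
      rw [hsub] at this
      exact this
    have h1 : π {c} = 1 := by
      rw [← prob_compl_eq_zero_iff (measurableSet_singleton c)]
      exact hae
    simpa [h1] using (Measure.ae_mem_finset_iff (μ := π) (s := {c})).1 (by simpa using hae)
  -- With this radius, points of the two balls are at least `2d` apart. If both balls contain a
  -- point mapped into `[-1, 1]`, then `2d |a| ≤ 2`, hence the threshold `1 / d`.
  set d := (q - p) / 4 with hd
  have hd0 : 0 < d := by rw [hd]; linarith
  have hpm : 0 < π.real (Metric.ball p d) :=
    ENNReal.toReal_pos ((Measure.mem_support_iff_forall _).1 hp _ (Metric.ball_mem_nhds p hd0)).ne'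
      (measure_ne_top _ _)
  have hqm : 0 < π.real (Metric.ball q d) :=
    ENNReal.toReal_pos ((Measure.mem_support_iff_forall _).1 hq _ (Metric.ball_mem_nhds q hd0)).ne'
      (measure_ne_top _ _)
  refine ⟨1 / d, by positivity, min (π.real (Metric.ball p d)) (π.real (Metric.ball q d)),
    lt_min hpm hqm, fun a z ha => ?_⟩
  by_contra! hlt
  have hmeet : ∀ c, tailMass π a z < π.real (Metric.ball c d) →
      ∃ y, |y - c| < d ∧ |a * y + z| ≤ 1 := by
    intro c hc
    by_contra! hno
    refine not_le.2 hc (measureReal_mono fun y hy => ?_)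
    exact hno y (by simpa [Real.dist_eq] using hy)
  obtain ⟨y, hy, hy1⟩ := hmeet p (hlt.trans_le (min_le_left _ _))
  obtain ⟨w, hw, hw1⟩ := hmeet q (hlt.trans_le (min_le_right _ _))
  have h2 : |a| * |w - y| ≤ 2 := by
    rw [← abs_mul]
    have : a * (w - y) = (a * w + z) - (a * y + z) := by ring
    rw [this]
    exact (abs_sub _ _).trans (by linarith)
  have h3 : 2 * d ≤ |w - y| := by
    rw [abs_lt] at hy hw
    exact le_trans (by linarith [hy.2, hw.1, hd]) (le_abs_self _)
  have h4 : 1 < |a| * d := by rwa [div_lt_iff₀ hd0] at ha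
  nlinarith [abs_nonneg a, mul_le_mul_of_nonneg_left h3 (abs_nonneg a)]

/-- If the affine recursion has a nondegenerate stationary law although `E log |A| ≥ 0`, then
`log |A| = 0` almost surely. -/
theorem IsStationary.log_abs_eq_zero (h : IsStationary ν π) (hπ : ∀ c, π ≠ Measure.dirac c)
    (hne : ∀ᵐ p ∂ν, p.1 ≠ 0) (hint : Integrable (fun p => Real.log |p.1|) ν)
    (hmean : 0 ≤ ∫ p, Real.log |p.1| ∂ν) : ∀ᵐ p ∂ν, Real.log |p.1| = 0 := by
  obtain ⟨K, hK, ε, hε, hKε⟩ := exists_le_tailMass hπ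
  set ψ : ℝ × ℝ → ℝ := fun p => min 1 (tailMass π p.1 p.2 / ε) with hψ
  have hψ0 : ∀ p, 0 ≤ ψ p := fun p => le_min zero_le_one (div_nonneg (tailMass_nonneg _ _) hε.le)
  have hψ1 : ∀ p, ψ p ≤ 1 := fun p => min_le_left _ _
  set S : ℝ → Set (ℝ × ℝ) := fun t => {p | K * Real.exp (-t) ≤ |p.1|} with hS
  have hmem : ∀ t, (K * Real.exp (-t), (0 : ℝ)) ∈ S t := by
    intro t
    simp only [hS, Set.mem_ofPred_eq]
    exact le_abs_self _
  have hbdd : ∀ t, BddBelow (ψ '' S t) := fun t => ⟨0, by rintro _ ⟨p, -, rfl⟩; exact hψ0 p⟩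
  -- The infimum runs over all translations, since the walk moves them too, and over all slopes
  -- above a threshold, which makes `G` monotone. Dividing by `ε` and capping at `1` gives `G = 1`
  -- on the negative half-line, where slopes exceed `K`.
  set G : ℝ → ℝ := fun t => sInf (ψ '' S t) with hG
  have hGle : ∀ t p, p ∈ S t → G t ≤ ψ p := fun t p hp => csInf_le (hbdd t) ⟨p, hp, rfl⟩
  have hG0 : ∀ t, 0 ≤ G t := fun t => Real.sInf_nonneg (by rintro _ ⟨p, -, rfl⟩; exact hψ0 p)
  have hle_G : ∀ t c, (∀ p ∈ S t, c ≤ ψ p) → c ≤ G t := fun t c hc =>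
    le_csInf ⟨_, _, hmem t, rfl⟩ (by rintro _ ⟨p, hp, rfl⟩; exact hc p hp)
  have hG1 : ∀ t, G t ≤ 1 := fun t => (hGle t _ (hmem t)).trans (hψ1 _)
  have hanti : Antitone G := by
    intro s t hst
    refine hle_G s _ fun p hp => hGle t p ?_
    simp only [hS, Set.mem_ofPred_eq] at hp ⊢
    refine le_trans ?_ hp
    have : Real.exp (-t) ≤ Real.exp (-s) := Real.exp_le_exp.2 (by linarith)
    nlinarith
  refine ae_eq_zero_of_superharmonic (by fun_prop) hint hmean hanti hG0 hG1 ?_ ?_ ?_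
  · intro t ht
    refine le_antisymm (hG1 t) (hle_G t 1 fun p hp => ?_)
    simp only [hS, Set.mem_ofPred_eq] at hp
    refine le_min le_rfl ((one_le_div hε).2 (hKε _ _ (lt_of_lt_of_le ?_ hp)))
    have : 1 < Real.exp (-t) := Real.one_lt_exp_iff.2 (by linarith)
    nlinarith
  · intro t _
    refine hle_G t _ fun q hq => ?_
    simp only [hS, Set.mem_ofPred_eq] at hq
    -- Composition multiplies the slope by `|p.1|`, so it lowers the logarithmic level `t` by `log
    -- |p.1|`. Integrating this bound against the harmonicity of the tail mass gives
    -- superharmonicity.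
    have hshift : ∀ᵐ p ∂ν, G (t - Real.log |p.1|) ≤ ψ (q.1 * p.1, q.1 * p.2 + q.2) := by
      filter_upwards [hne] with p hp
      apply hGle
      simp only [hS, Set.mem_ofPred_eq]
      rw [neg_sub, sub_eq_neg_add, Real.exp_add, Real.exp_log (abs_pos.2 hp), abs_mul, ← mul_assoc]
      exact mul_le_mul_of_nonneg_right hq (abs_nonneg _)
    have hGi : Integrable (fun p : ℝ × ℝ => G (t - Real.log |p.1|)) ν :=
      Integrable.of_bound (C := 1)
        (hanti.measurable.comp (by fun_prop)).aestronglyMeasurable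
        (Eventually.of_forall fun p => by
          rw [Real.norm_eq_abs, abs_of_nonneg (hG0 _)]; exact hG1 _)
    refine le_min ?_ ?_
    · calc ∫ p, G (t - Real.log |p.1|) ∂ν ≤ ∫ _, (1 : ℝ) ∂ν :=
            integral_mono hGi (integrable_const _) fun p => hG1 _
        _ = 1 := by simp
    · rw [h.tailMass_eq q.1 q.2, ← integral_div]
      refine integral_mono_ae hGi ?_ ?_
      · refine Integrable.div_const (Integrable.of_bound (C := 1) ?_
          (Eventually.of_forall fun p => ?_)) _
        · exact (measurable_tailMass.comp (g := fun p : ℝ × ℝ => tailMass π p.1 p.2)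
            (f := fun p : ℝ × ℝ => (q.1 * p.1, q.1 * p.2 + q.2)) (by fun_prop)).aestronglyMeasurable
        · rw [Real.norm_eq_abs, abs_of_nonneg (tailMass_nonneg _ _)]
          exact tailMass_le_one _ _
      · filter_upwards [hshift] with p hp
        exact hp.trans (min_le_right _ _)
  · have hl : Tendsto (fun t : ℝ => tailMass π (K * Real.exp (-t)) 0 / ε) atTop (𝓝 0) := by
      have h1 : Tendsto (fun t : ℝ => K * Real.exp (-t)) atTop (𝓝 0) := by
        simpa using (Real.tendsto_exp_neg_atTop_nhds_zero).const_mul K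
      simpa using (tendsto_tailMass_zero.comp h1).div_const ε
    exact squeeze_zero hG0 (fun t => (hGle t _ (hmem t)).trans (min_le_right _ _)) hl

end Stationary

/-! ### Slopes of modulus one, and nonexistence of a stationary law -/

/-- The cubic Taylor bound `|u|³ / 6` suffices up to `|u| = 6`, and `|u| + 1` beyond. A quadratic
bound is wanted because the noise has only two moments. -/
theorem abs_sin_sub_self_le_sq (u : ℝ) : |Real.sin u - u| ≤ u ^ 2 := by
  rw [abs_sub_comm]
  rcases le_total |u| 6 with h | h
  · refine (Real.abs_sub_sin_le u).trans ?_
    rw [← sq_abs u]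
    nlinarith [sq_nonneg |u|]
  · have h1 : |u - Real.sin u| ≤ |u| + |Real.sin u| := abs_sub _ _
    have h2 := Real.abs_sin_le_one u
    rw [← sq_abs u]
    nlinarith

theorem tendsto_one_sub_cos_div_sq (x : ℝ) :
    Tendsto (fun n : ℕ => (1 - Real.cos ((1 / ((n : ℝ) + 1)) * x)) / (1 / ((n : ℝ) + 1)) ^ 2) atTop
      (𝓝 (x ^ 2 / 2)) := by
  have ht : Tendsto (fun n : ℕ => 1 / ((n : ℝ) + 1)) atTop (𝓝 0) :=
    tendsto_one_div_add_atTop_nhds_zero_nat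
  have hb : ∀ᶠ n : ℕ in atTop, |1 / ((n : ℝ) + 1) * x| ≤ 1 := by
    have h0 : Tendsto (fun n : ℕ => |1 / ((n : ℝ) + 1) * x|) atTop (𝓝 0) := by
      simpa using (ht.mul_const x).abs
    exact (h0.eventually_lt_const one_pos).mono fun n hn => hn.le
  have hl : Tendsto (fun n : ℕ => (1 / ((n : ℝ) + 1)) ^ 2 * (x ^ 4 * (5 / 96))) atTop (𝓝 0) := by
    simpa using (ht.pow 2).mul_const (x ^ 4 * (5 / 96))
  rw [tendsto_iff_norm_sub_tendsto_zero]
  refine squeeze_zero' (Eventually.of_forall fun _ => norm_nonneg _) ?_ hl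
  filter_upwards [hb] with n hn
  have hpos : (0 : ℝ) < 1 / ((n : ℝ) + 1) := by positivity
  set t := 1 / ((n : ℝ) + 1)
  have h1 := Real.cos_bound hn
  have h2 : (1 - Real.cos (t * x)) / t ^ 2 - x ^ 2 / 2
      = -(Real.cos (t * x) - (1 - (t * x) ^ 2 / 2)) / t ^ 2 := by
    field_simp
    ring
  rw [h2, Real.norm_eq_abs, abs_div, abs_neg, abs_of_pos (pow_pos hpos 2),
    div_le_iff₀ (pow_pos hpos 2)]
  refine h1.trans (le_of_eq ?_)
  rw [abs_mul, abs_of_pos hpos, mul_pow, pow_abs, abs_of_nonneg (by positivity : (0 : ℝ) ≤ x ^ 4)]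
  ring

section Stationary

variable {ν : Measure (ℝ × ℝ)} [IsProbabilityMeasure ν] {π : Measure ℝ} [IsProbabilityMeasure π]

/-- An affine recursion with slopes `±1` and centered noise of positive variance, uncorrelated
with the slope, has no stationary law. -/
theorem not_isStationary_of_abs_eq_one {σsq : ℝ} (hA : ∀ᵐ p ∂ν, |p.1| = 1)
    (hB : MemLp (fun p : ℝ × ℝ => p.2) 2 ν) (hAB : ∫ p, p.1 * p.2 ∂ν = 0)
    (hBsq : ∫ p, p.2 ^ 2 ∂ν = σsq) (hσ : 0 < σsq) : ¬ IsStationary ν π := by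
  intro h
  have hBi : Integrable (fun p : ℝ × ℝ => p.2) ν := hB.integrable (by norm_num)
  have hB2 : Integrable (fun p : ℝ × ℝ => p.2 ^ 2) ν := hB.integrable_sq
  have hAbd : ∀ᵐ p ∂ν, ‖p.1‖ ≤ 1 := hA.mono fun p hp => le_of_eq hp
  have hABi : Integrable (fun p : ℝ × ℝ => p.1 * p.2) ν :=
    hBi.bdd_mul measurable_fst.aestronglyMeasurable hAbd
  have hASi : ∀ t : ℝ, Integrable (fun p : ℝ × ℝ => p.1 * Real.sin (t * p.2)) ν := fun t => by
    refine Integrable.of_bound (C := 1) (by fun_prop) (hA.mono fun p hp => ?_)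
    rw [norm_mul, Real.norm_eq_abs, Real.norm_eq_abs, hp, one_mul]
    exact Real.abs_sin_le_one _
  have hcosi : ∀ t : ℝ, Integrable (fun p : ℝ × ℝ => Real.cos (t * p.2)) ν := fun t =>
    Integrable.of_bound (C := 1) (by fun_prop)
      (Eventually.of_forall fun p => Real.abs_cos_le_one _)
  have hCi : ∀ t : ℝ, Integrable (fun y : ℝ => Real.cos (t * y)) π := fun t =>
    Integrable.of_bound (C := 1) (by fun_prop)
      (Eventually.of_forall fun p => Real.abs_cos_le_one _)
  have hSi : ∀ t : ℝ, Integrable (fun y : ℝ => Real.sin (t * y)) π := fun t =>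
    Integrable.of_bound (C := 1) (by fun_prop)
      (Eventually.of_forall fun p => Real.abs_sin_le_one _)
  set C : ℝ → ℝ := fun t => ∫ y, Real.cos (t * y) ∂π with hC
  set S : ℝ → ℝ := fun t => ∫ y, Real.sin (t * y) ∂π with hS
  -- Stationarity tested on `y ↦ cos (t y)`. For `A = ±1` the addition formula gives `cos (t A y) =
  -- cos (t y)` and `sin (t A y) = A sin (t y)`, so the `y` and `(A, B)` parts separate.
  have hid : ∀ t, C t * ∫ p, (1 - Real.cos (t * p.2)) ∂ν
      = - (S t * ∫ p, p.1 * Real.sin (t * p.2) ∂ν) := by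
    intro t
    have h1 := h.integral_eq (f := fun y => Real.cos (t * y)) (by fun_prop) (C := 1)
      (fun y => Real.abs_cos_le_one _)
    have h2 : ∀ᵐ p ∂ν, ∫ y, Real.cos (t * (p.1 * y + p.2)) ∂π
        = C t * Real.cos (t * p.2) - S t * (p.1 * Real.sin (t * p.2)) := by
      filter_upwards [hA] with p hp
      have h3 : ∀ y, Real.cos (t * (p.1 * y + p.2))
          = Real.cos (t * y) * Real.cos (t * p.2)
            - Real.sin (t * y) * (p.1 * Real.sin (t * p.2)) := by
        intro y
        rcases eq_or_eq_neg_of_abs_eq hp with h | h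
        · rw [h, one_mul, mul_add, Real.cos_add, one_mul]
        · rw [h, mul_add, Real.cos_add, neg_one_mul, mul_neg, Real.cos_neg, Real.sin_neg]
          ring
      simp_rw [h3]
      rw [integral_sub ((hCi t).mul_const _) ((hSi t).mul_const _), integral_mul_const,
        integral_mul_const]
    rw [integral_congr_ae h2, integral_sub ((hcosi t).const_mul _) ((hASi t).const_mul _),
      integral_const_mul, integral_const_mul] at h1
    rw [integral_sub (integrable_const _) (hcosi t)]
    simp only [integral_const, probReal_univ, smul_eq_mul, mul_one]
    have h4 : C t = ∫ y, Real.cos (t * y) ∂π := rfl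
    rw [mul_sub, mul_one]
    linarith
  -- Since `E A B = 0`, the linear term of the sine may be subtracted. After division of `hid` by
  -- `t²`, the left side tends to `σ² / 2` and the right side is at most `|S t| σ² → 0`.
  have hsin : ∀ t, |∫ p, p.1 * Real.sin (t * p.2) ∂ν| ≤ t ^ 2 * σsq := by
    intro t
    have h1 : ∫ p, p.1 * Real.sin (t * p.2) ∂ν
        = ∫ p, (p.1 * Real.sin (t * p.2) - t * (p.1 * p.2)) ∂ν := by
      rw [integral_sub (hASi t) (hABi.const_mul t), integral_const_mul, hAB]; simp
    rw [h1, ← hBsq, ← integral_const_mul]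
    rw [← Real.norm_eq_abs]
    refine norm_integral_le_of_norm_le (hB2.const_mul _) (hA.mono fun p hp => ?_)
    have : p.1 * Real.sin (t * p.2) - t * (p.1 * p.2)
        = p.1 * (Real.sin (t * p.2) - t * p.2) := by ring
    rw [this, norm_mul, Real.norm_eq_abs, Real.norm_eq_abs, hp, one_mul, ← mul_pow]
    exact abs_sin_sub_self_le_sq _
  set t : ℕ → ℝ := fun n => 1 / ((n : ℝ) + 1) with ht
  have htpos : ∀ n, 0 < t n := fun n => by positivity
  have htlim : Tendsto t atTop (𝓝 0) := tendsto_one_div_add_atTop_nhds_zero_nat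
  have hClim : Tendsto (fun n => C (t n)) atTop (𝓝 1) := by
    have h1 : (1 : ℝ) = ∫ y : ℝ, (1 : ℝ) ∂π := by simp
    rw [h1]
    refine tendsto_integral_of_dominated_convergence (fun _ => 1) (fun n => by fun_prop)
      (integrable_const _)
      (fun n => Eventually.of_forall fun y => Real.abs_cos_le_one _)
      (Eventually.of_forall fun y => ?_)
    have := (Real.continuous_cos.tendsto 0).comp (by simpa using htlim.mul_const y)
    simpa [Function.comp_def] using this
  have hSlim : Tendsto (fun n => S (t n)) atTop (𝓝 0) := by
    have h1 : (0 : ℝ) = ∫ y : ℝ, (0 : ℝ) ∂π := by simp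
    rw [h1]
    refine tendsto_integral_of_dominated_convergence (fun _ => 1) (fun n => by fun_prop)
      (integrable_const _)
      (fun n => Eventually.of_forall fun y => Real.abs_sin_le_one _)
      (Eventually.of_forall fun y => ?_)
    have := (Real.continuous_sin.tendsto 0).comp (by simpa using htlim.mul_const y)
    simpa [Function.comp_def] using this
  have hBlim : Tendsto (fun n => (∫ p, (1 - Real.cos (t n * p.2)) ∂ν) / t n ^ 2) atTop
      (𝓝 (σsq / 2)) := by
    have h1 : σsq / 2 = ∫ p, p.2 ^ 2 / 2 ∂ν := by rw [integral_div, hBsq]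
    rw [h1]
    simp_rw [← integral_div]
    refine tendsto_integral_of_dominated_convergence (fun p => p.2 ^ 2 / 2) (fun n => by fun_prop)
      (hB2.div_const 2) (fun n => Eventually.of_forall fun p => ?_)
      (Eventually.of_forall fun p => tendsto_one_sub_cos_div_sq p.2)
    have h2 := Real.one_sub_sq_div_two_le_cos (x := t n * p.2)
    have h3 := Real.cos_le_one (t n * p.2)
    rw [Real.norm_eq_abs, abs_of_nonneg (div_nonneg (by linarith) (sq_nonneg _)),
      div_le_iff₀ (pow_pos (htpos n) 2)]
    nlinarith
  have hL : Tendsto (fun n => C (t n) * ((∫ p, (1 - Real.cos (t n * p.2)) ∂ν) / t n ^ 2)) atTop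
      (𝓝 (1 * (σsq / 2))) := hClim.mul hBlim
  have hR : Tendsto (fun n => C (t n) * ((∫ p, (1 - Real.cos (t n * p.2)) ∂ν) / t n ^ 2)) atTop
      (𝓝 0) := by
    have h1 : Tendsto (fun n => |S (t n)| * σsq) atTop (𝓝 0) := by
      simpa using hSlim.abs.mul_const σsq
    refine squeeze_zero_norm (fun n => ?_) h1
    have hp := pow_pos (htpos n) 2
    rw [← mul_div_assoc, hid, Real.norm_eq_abs, abs_div, abs_neg, abs_mul, abs_of_pos hp,
      div_le_iff₀ hp]
    calc |S (t n)| * |∫ p, p.1 * Real.sin (t n * p.2) ∂ν| ≤ |S (t n)| * (t n ^ 2 * σsq) :=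
          mul_le_mul_of_nonneg_left (hsin _) (abs_nonneg _)
      _ = |S (t n)| * σsq * t n ^ 2 := by ring
  have := tendsto_nhds_unique hL hR
  linarith

/-- A random affine recursion `y ↦ A y + B` with `E log |A| ≥ 0`, square integrable coefficients,
`E B = 0`, `E A B = 0` and `E B² > 0` has no stationary law. -/
theorem not_isStationary {σsq : ℝ} (hne : ∀ᵐ p ∂ν, p.1 ≠ 0)
    (hint : Integrable (fun p => Real.log |p.1|) ν) (hmean : 0 ≤ ∫ p, Real.log |p.1| ∂ν)
    (hA2 : MemLp (fun p : ℝ × ℝ => p.1) 2 ν) (hB : MemLp (fun p : ℝ × ℝ => p.2) 2 ν)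
    (hB0 : ∫ p, p.2 ∂ν = 0) (hAB : ∫ p, p.1 * p.2 ∂ν = 0)
    (hBsq : ∫ p, p.2 ^ 2 ∂ν = σsq) (hσ : 0 < σsq) : ¬ IsStationary ν π := by
  intro h
  by_cases hπ : ∃ c, π = Measure.dirac c
  · obtain ⟨c, hc⟩ := hπ
    have hm : Measurable fun p : ℝ × ℝ => p.1 * c + p.2 := by fun_prop
    have hlaw : ν.map (fun p => p.1 * c + p.2) = Measure.dirac c := by
      have h1 := h
      rw [IsStationary, hc, Measure.prod_dirac, Measure.map_map (by fun_prop) (by fun_prop)] at h1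
      exact h1
    have hae : ∀ᵐ p ∂ν, p.1 * c + p.2 = c := by
      refine ae_of_ae_map hm.aemeasurable (p := fun y => y = c) ?_
      rw [hlaw, ae_dirac_eq]
      simp
    have hABi : Integrable (fun p : ℝ × ℝ => p.1 * p.2) ν := hA2.integrable_mul hB
    have hBi : Integrable (fun p : ℝ × ℝ => p.2) ν := hB.integrable (by norm_num)
    -- Multiplying `A c + B = c` by `B` gives `B² = c B - c A B`, whose mean is zero.
    have h2 : ∫ p, p.2 ^ 2 ∂ν = ∫ p, (c * p.2 - c * (p.1 * p.2)) ∂ν := by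
      refine integral_congr_ae (hae.mono fun p hp => ?_)
      have : p.2 = c - p.1 * c := by linarith
      linear_combination p.2 * this
    rw [integral_sub (hBi.const_mul c) (hABi.const_mul c), integral_const_mul, integral_const_mul,
      hB0, hAB, hBsq] at h2
    linarith
  · push Not at hπ
    refine not_isStationary_of_abs_eq_one ?_ hB hAB hBsq hσ h
    filter_upwards [h.log_abs_eq_zero hπ hne hint hmean, hne] with p hp hp0
    exact Real.eq_one_of_pos_of_log_eq_zero (abs_pos.2 hp0) hp

end Stationary

/-! ### Compactness and construction of a stationary law -/

/-- Vague sequential compactness of laws on the line, along an ultrafilter. -/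
theorem exists_vague_limit (m : ℕ → Measure ℝ) [∀ n, IsProbabilityMeasure (m n)]
    (U : Ultrafilter ℕ) :
    ∃ ρ : Measure ℝ, IsFiniteMeasure ρ ∧ ∀ f : ℝ → ℝ, Continuous f →
      Tendsto f (cocompact ℝ) (𝓝 0) →
        Tendsto (fun n => ∫ y, f y ∂(m n)) U (𝓝 (∫ y, f y ∂ρ)) := by
  let _ : MeasurableSpace (OnePoint ℝ) := borel (OnePoint ℝ)
  have _ : BorelSpace (OnePoint ℝ) := ⟨rfl⟩
  have hemb : MeasurableEmbedding ((↑) : ℝ → OnePoint ℝ) :=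
    OnePoint.isOpenEmbedding_coe.measurableEmbedding
  -- On the one-point compactification the probability measures form a compact space. Functions
  -- vanishing at infinity extend by `0`, so any mass escaping to the added point is invisible to
  -- them.
  let M : ℕ → ProbabilityMeasure (OnePoint ℝ) := fun n =>
    ⟨(m n).map (↑), Measure.isProbabilityMeasure_map hemb.measurable.aemeasurable⟩
  obtain ⟨μ, -, hμ⟩ := isCompact_univ.ultrafilter_le_nhds (U.map M) (by simp)
  have hμ' : Tendsto M U (𝓝 μ) := hμ
  rw [ProbabilityMeasure.tendsto_iff_forall_integral_tendsto] at hμ'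
  refine ⟨(μ : Measure (OnePoint ℝ)).comap (↑), ⟨?_⟩, fun f hf hf0 => ?_⟩
  · rw [hemb.comap_apply]
    exact measure_lt_top _ _
  · have hc : Continuous fun x : OnePoint ℝ => x.elim 0 f := by
      rw [OnePoint.continuous_iff]
      refine ⟨?_, hf⟩
      rw [coclosedCompact_eq_cocompact]
      exact hf0
    have h1 := hμ' (BoundedContinuousFunction.mkOfCompact ⟨_, hc⟩)
    have h2 : ∀ n, ∫ x, (BoundedContinuousFunction.mkOfCompact ⟨_, hc⟩ : _) x
        ∂(M n : Measure (OnePoint ℝ)) = ∫ y, f y ∂(m n) := fun n =>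
      hemb.integral_map _
    simp_rw [h2] at h1
    convert h1 using 2
    have h3 := hemb.integral_map (μ := (μ : Measure (OnePoint ℝ)).comap (↑))
      (fun x : OnePoint ℝ => x.elim 0 f)
    rw [hemb.map_comap] at h3
    refine h3.symm.trans (setIntegral_eq_integral_of_forall_compl_eq_zero fun x hx => ?_)
    induction x using OnePoint.rec with
    | infty => rfl
    | coe x => exact absurd ⟨x, rfl⟩ hx

/-- If Cesàro-type averages of the laws of an affine recursion do not escape to infinity, then the
recursion has a stationary law. -/
theorem exists_isStationary {ν : Measure (ℝ × ℝ)} [IsProbabilityMeasure ν]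
    (hne : ∀ᵐ p ∂ν, p.1 ≠ 0) (m : ℕ → Measure ℝ) [∀ n, IsProbabilityMeasure (m n)]
    (hm : ∀ f : ℝ → ℝ, Continuous f → (∃ C, ∀ y, |f y| ≤ C) →
      Tendsto (fun n => ∫ y, (∫ p, f (p.1 * y + p.2) ∂ν) ∂(m n) - ∫ y, f y ∂(m n)) atTop (𝓝 0))
    {r : ℝ → ℝ} (hr : Continuous r) (hr0 : Tendsto r (cocompact ℝ) (𝓝 0))
    (hnot : ¬ Tendsto (fun n => ∫ y, r y ∂(m n)) atTop (𝓝 0)) :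
    ∃ π : Measure ℝ, IsProbabilityMeasure π ∧ IsStationary ν π := by
  rw [tendsto_iff_ultrafilter] at hnot
  push Not at hnot
  obtain ⟨U, hU, hUr⟩ := hnot
  obtain ⟨ρ, hρ, hlim⟩ := exists_vague_limit m U
  have hρ0 : ρ ≠ 0 := by
    rintro rfl
    exact hUr (by simpa using hlim r hr hr0)
  have hinv : ∀ f : ℝ → ℝ, Continuous f → HasCompactSupport f →
      ∫ y, (∫ p, f (p.1 * y + p.2) ∂ν) ∂ρ = ∫ y, f y ∂ρ := by
    intro f hf hfc
    obtain ⟨C, hC⟩ := hfc.exists_bound_of_continuous hf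
    have hf0 : Tendsto f (cocompact ℝ) (𝓝 0) := hfc.is_zero_at_infty
    have hTc : Continuous fun y => ∫ p, f (p.1 * y + p.2) ∂ν :=
      continuous_of_dominated (bound := fun _ => C)
        (fun y => (hf.measurable.comp (by fun_prop)).aestronglyMeasurable)
        (fun y => Eventually.of_forall fun p => hC _) (integrable_const _)
        (Eventually.of_forall fun p => by fun_prop)
    -- This is where `A ≠ 0` enters: for a nonzero slope `A y + B` leaves every compact set with
    -- `y`. Hence the vague limit may also be tested on the averaged function.
    have hT0 : Tendsto (fun y => ∫ p, f (p.1 * y + p.2) ∂ν) (cocompact ℝ) (𝓝 0) := by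
      have : (cocompact ℝ).IsCountablyGenerated := by
        rw [cocompact_eq_atBot_atTop]; infer_instance
      have h0 : (0 : ℝ) = ∫ _, (0 : ℝ) ∂ν := by simp
      rw [h0]
      refine tendsto_integral_filter_of_dominated_convergence (fun _ => C)
        (Eventually.of_forall fun y => (hf.measurable.comp (by fun_prop)).aestronglyMeasurable)
        (Eventually.of_forall fun y => Eventually.of_forall fun p => hC _) (integrable_const _) ?_
      filter_upwards [hne] with p hp
      exact hf0.comp (((Homeomorph.mulLeft₀ p.1 hp).trans
        (Homeomorph.addRight p.2)).isClosedEmbedding.tendsto_cocompact)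
    have h1 := (hlim _ hTc hT0).sub (hlim f hf hf0)
    have h2 := (hm f hf ⟨C, hC⟩).mono_left hU
    exact sub_eq_zero.1 (tendsto_nhds_unique h1 h2)
  have : NeZero ρ := ⟨hρ0⟩
  refine ⟨(ρ Set.univ)⁻¹ • ρ, inferInstance, ?_⟩
  set π := (ρ Set.univ)⁻¹ • ρ with hπ
  have hprob : IsProbabilityMeasure π := inferInstance
  have hmeas : Measurable fun p : (ℝ × ℝ) × ℝ => p.1.1 * p.2 + p.1.2 := by fun_prop
  have : IsProbabilityMeasure ((ν.prod π).map fun p => p.1.1 * p.2 + p.1.2) :=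
    Measure.isProbabilityMeasure_map hmeas.aemeasurable
  refine Measure.ext_of_integral_eq_on_compactlySupported fun f => ?_
  have hf : Continuous f := map_continuous f
  obtain ⟨C, hC⟩ := f.hasCompactSupport.exists_bound_of_continuous hf
  have hi : Integrable (fun p : (ℝ × ℝ) × ℝ => f (p.1.1 * p.2 + p.1.2)) (ν.prod π) :=
    Integrable.of_bound (C := C) (hf.measurable.comp hmeas).aestronglyMeasurable
      (Eventually.of_forall fun p => hC _)
  rw [integral_map hmeas.aemeasurable hf.measurable.aestronglyMeasurable,
    integral_prod_symm _ hi, hπ, integral_smul_measure, integral_smul_measure,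
    hinv f hf f.hasCompactSupport]

/-! ### The autoregression as a Markov chain, and its escape to infinity -/

section Recursion

variable {Ω : Type*} [MeasurableSpace Ω] {P : Measure Ω} {b e : ℕ → Ω → ℝ} {φ x₀ : ℝ}

theorem measurable_process (hb : ∀ k, Measurable (b k)) (he : ∀ k, Measurable (e k)) (k : ℕ) :
    Measurable (process φ x₀ b e k) := by
  induction k with
  | zero => exact measurable_const
  | succ k ih => exact ((measurable_const.add (hb _)).mul ih).add (he _)

/-- The process depends on the innovations up to the present time only. -/
theorem process_congr {Ω Ω' : Type*} {b e : ℕ → Ω → ℝ} {b' e' : ℕ → Ω' → ℝ}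
    {φ x₀ : ℝ} {z : Ω} {z' : Ω'} {k : ℕ}
    (hb : ∀ j ≤ k, b j z = b' j z') (he : ∀ j ≤ k, e j z = e' j z') :
    process φ x₀ b e k z = process φ x₀ b' e' k z' := by
  induction k with
  | zero => rfl
  | succ k ih =>
    rw [process, process, hb _ le_rfl, he _ le_rfl,
      ih (fun j hj => hb j (by omega)) (fun j hj => he j (by omega))]

theorem indepFun_process (hb : ∀ k, Measurable (b k)) (he : ∀ k, Measurable (e k))
    (hind : iIndepFun (fun k z => (b k z, e k z)) P) (k : ℕ) :
    IndepFun (fun z => (b (k + 1) z, e (k + 1) z)) (process φ x₀ b e k) P := by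
  set ξ : ℕ → Ω → ℝ × ℝ := fun k z => (b k z, e k z) with hξ
  have hξm : ∀ i, Measurable (ξ i) := fun i => (hb i).prodMk (he i)
  have h := hind.indepFun_finset {k + 1} (Finset.range (k + 1)) (by simp) hξm
  -- Padding the finite tuple of innovations with zeros allows `process` itself to express the state
  -- at time `k` as a measurable function of them.
  let ext : ((i : Finset.range (k + 1)) → ℝ × ℝ) → ℕ → ℝ × ℝ := fun w i =>
    if hi : i ∈ Finset.range (k + 1) then w ⟨i, hi⟩ else 0
  have hext : ∀ i, Measurable fun w => ext w i := by
    intro i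
    by_cases hi : i ∈ Finset.range (k + 1)
    · simp only [ext, hi, dite_true]; exact measurable_pi_apply _
    · simp only [ext, hi, dite_false]; exact measurable_const
  let F : ((i : Finset.range (k + 1)) → ℝ × ℝ) → ℝ :=
    process φ x₀ (fun i w => (ext w i).1) (fun i w => (ext w i).2) k
  have hF : Measurable F := measurable_process (fun i => (hext i).fst) (fun i => (hext i).snd) k
  have h2 := h.comp (ψ := F)
    (measurable_pi_apply (⟨k + 1, Finset.mem_singleton_self _⟩ : ({k + 1} : Finset ℕ))) hF
  have heq : process φ x₀ b e k
      = F ∘ fun z (i : Finset.range (k + 1)) => ξ i z := by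
    ext z
    refine process_congr (fun j hj => ?_) (fun j hj => ?_)
    · have : j ∈ Finset.range (k + 1) := Finset.mem_range.2 (by omega)
      simp only [ext, this, dite_true, hξ]
    · have : j ∈ Finset.range (k + 1) := Finset.mem_range.2 (by omega)
      simp only [ext, this, dite_true, hξ]
  rw [heq]
  exact h2

theorem integral_innovation_mul (hb : ∀ k, Measurable (b k)) (he : ∀ k, Measurable (e k))
    (hind : iIndepFun (fun k z => (b k z, e k z)) P)
    (hid : ∀ k, IdentDistrib (fun z => (b k z, e k z)) (fun z => (b 0 z, e 0 z)) P P)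
    {g : ℝ × ℝ → ℝ} (hg : Measurable g) {r : ℝ → ℝ} (hr : Measurable r) (k : ℕ) :
    ∫ z, g (b (k + 1) z, e (k + 1) z) * r (process φ x₀ b e k z) ∂P
      = (∫ z, g (b 0 z, e 0 z) ∂P) * ∫ z, r (process φ x₀ b e k z) ∂P := by
  have h := (indepFun_process (φ := φ) (x₀ := x₀) hb he hind k).comp hg hr
  have h1 := h.integral_mul_eq_mul_integral
    (hg.comp ((hb _).prodMk (he _))).aestronglyMeasurable
    (hr.comp (measurable_process hb he k)).aestronglyMeasurable
  have h2 := ((hid (k + 1)).comp hg).integral_eq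
  simp only [Pi.mul_apply, Function.comp_apply] at h1 h2
  rw [h1, h2]

theorem measurable_integral_affine {ν : Measure (ℝ × ℝ)} [SFinite ν] {f : ℝ → ℝ}
    (hf : Measurable f) : Measurable fun y => ∫ p, f (p.1 * y + p.2) ∂ν :=
  (StronglyMeasurable.integral_prod_right (f := fun y (p : ℝ × ℝ) => f (p.1 * y + p.2))
    (hf.comp (by fun_prop : Measurable fun q : ℝ × ℝ × ℝ =>
      q.2.1 * q.1 + q.2.2)).stronglyMeasurable).measurable

variable [IsProbabilityMeasure P]

/-- The law of the random affine map `y ↦ (φ + b₀) y + e₀`. -/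
def stepLaw (P : Measure Ω) (φ : ℝ) (b e : ℕ → Ω → ℝ) : Measure (ℝ × ℝ) :=
  P.map fun z => (φ + b 0 z, e 0 z)

/-- The Markov property: the next innovation is independent of the present state, so their joint law
is a product and Fubini applies. -/
theorem integral_process_succ (hb : ∀ k, Measurable (b k)) (he : ∀ k, Measurable (e k))
    (hind : iIndepFun (fun k z => (b k z, e k z)) P)
    (hid : ∀ k, IdentDistrib (fun z => (b k z, e k z)) (fun z => (b 0 z, e 0 z)) P P)
    {f : ℝ → ℝ} (hf : Measurable f) {C : ℝ} (hC : ∀ y, |f y| ≤ C) (k : ℕ) :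
    ∫ z, f (process φ x₀ b e (k + 1) z) ∂P
      = ∫ z, (∫ p, f (p.1 * process φ x₀ b e k z + p.2) ∂(stepLaw P φ b e)) ∂P := by
  have hX := measurable_process (φ := φ) (x₀ := x₀) hb he k
  have hξ : ∀ k, Measurable fun z => (φ + b k z, e k z) := fun k =>
    (measurable_const.add (hb k)).prodMk (he k)
  have hid' : P.map (fun z => (φ + b (k + 1) z, e (k + 1) z)) = stepLaw P φ b e :=
    ((hid (k + 1)).comp (u := fun p : ℝ × ℝ => (φ + p.1, p.2)) (by fun_prop)).map_eq
  have hprob : IsProbabilityMeasure (stepLaw P φ b e) :=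
    Measure.isProbabilityMeasure_map (hξ 0).aemeasurable
  have hXprob : IsProbabilityMeasure (P.map (process φ x₀ b e k)) :=
    Measure.isProbabilityMeasure_map hX.aemeasurable
  have hI : IndepFun (fun z => (φ + b (k + 1) z, e (k + 1) z)) (process φ x₀ b e k) P :=
    (indepFun_process (φ := φ) (x₀ := x₀) hb he hind k).comp
      (φ := fun p : ℝ × ℝ => (φ + p.1, p.2)) (ψ := id) (by fun_prop) measurable_id
  have hjoint := (indepFun_iff_map_prod_eq_prod_map_map (hξ (k + 1)).aemeasurable
    hX.aemeasurable).1 hI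
  rw [hid'] at hjoint
  have hm : Measurable fun p : (ℝ × ℝ) × ℝ => f (p.1.1 * p.2 + p.1.2) := hf.comp (by fun_prop)
  have hi : Integrable (fun p : (ℝ × ℝ) × ℝ => f (p.1.1 * p.2 + p.1.2))
      ((stepLaw P φ b e).prod (P.map (process φ x₀ b e k))) :=
    Integrable.of_bound (C := C) hm.aestronglyMeasurable (Eventually.of_forall fun p => hC _)
  have h1 := integral_prod_symm _ hi
  rw [← hjoint, integral_map ((hξ _).prodMk hX).aemeasurable hm.aestronglyMeasurable,
    integral_map hX.aemeasurable] at h1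
  · exact h1
  · exact (measurable_integral_affine hf).aestronglyMeasurable

/-- The random coefficient autoregression leaves every bounded set, on time average. -/
theorem tendsto_cesaro_zero (hb : ∀ k, Measurable (b k)) (he : ∀ k, Measurable (e k))
    (hind : iIndepFun (fun k z => (b k z, e k z)) P)
    (hid : ∀ k, IdentDistrib (fun z => (b k z, e k z)) (fun z => (b 0 z, e 0 z)) P P)
    {σsq : ℝ} (hb2 : MemLp (b 0) 2 P) (he2 : MemLp (e 0) 2 P) (he0 : ∫ z, e 0 z ∂P = 0)
    (hesq : ∫ z, e 0 z ^ 2 ∂P = σsq) (hσ : 0 < σsq) (hcov : cov[b 0, e 0; P] = 0)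
    (hlog : LogMeanNonneg P (fun z => φ + b 0 z))
    {r : ℝ → ℝ} (hr : Continuous r) (hr0 : Tendsto r (cocompact ℝ) (𝓝 0)) :
    Tendsto (fun n : ℕ => 1 / ((n : ℝ) + 1) *
      ∑ k ∈ Finset.range (n + 1), ∫ z, r (process φ x₀ b e k z) ∂P) atTop (𝓝 0) := by
  set X := process φ x₀ b e with hXdef
  have hX : ∀ k, Measurable (X k) := fun k => measurable_process hb he k
  have hξ : Measurable fun z => (φ + b 0 z, e 0 z) := (measurable_const.add (hb 0)).prodMk (he 0)
  set ν := stepLaw P φ b e with hν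
  have hprob : IsProbabilityMeasure ν := Measure.isProbabilityMeasure_map hξ.aemeasurable
  have hXprob : ∀ k, IsProbabilityMeasure (P.map (X k)) := fun k =>
    Measure.isProbabilityMeasure_map (hX k).aemeasurable
  let m : ℕ → Measure ℝ := fun n =>
    ((n : ℝ≥0∞) + 1)⁻¹ • ∑ k ∈ Finset.range (n + 1), P.map (X k)
  have hm1 : ∀ n, IsProbabilityMeasure (m n) := by
    intro n
    constructor
    simp only [m, Measure.smul_apply, Measure.finsetSum_apply, measure_univ, Finset.sum_const,
      Finset.card_range, nsmul_eq_mul, mul_one, smul_eq_mul]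
    push_cast
    exact ENNReal.inv_mul_cancel (by simp) (by finiteness)
  have hint : ∀ f : ℝ → ℝ, Measurable f → (∃ C, ∀ y, |f y| ≤ C) → ∀ n, ∫ y, f y ∂(m n)
      = 1 / ((n : ℝ) + 1) * ∑ k ∈ Finset.range (n + 1), ∫ z, f (X k z) ∂P := by
    rintro f hf ⟨C, hC⟩ n
    have h1 : ∀ k ∈ Finset.range (n + 1), Integrable f (P.map (X k)) := fun k _ =>
      Integrable.of_bound (C := C) hf.aestronglyMeasurable (Eventually.of_forall hC)
    rw [integral_smul_measure, integral_finsetSum_measure h1, smul_eq_mul, ENNReal.toReal_inv,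
      ENNReal.toReal_add (by finiteness) (by finiteness)]
    simp only [ENNReal.toReal_natCast, ENNReal.toReal_one, one_div]
    congr 1
    refine Finset.sum_congr rfl fun k _ => ?_
    rw [integral_map (hX k).aemeasurable hf.aestronglyMeasurable]
  by_contra hnot
  obtain ⟨C, hC⟩ : ∃ C, ∀ y, |r y| ≤ C := by
    obtain ⟨C, hC⟩ := (ZeroAtInftyContinuousMap.isBounded_range (⟨⟨r, hr⟩, hr0⟩ :
      ZeroAtInftyContinuousMap ℝ ℝ)).exists_norm_le
    exact ⟨C, fun y => hC _ ⟨y, rfl⟩⟩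
  have hbe : ∫ z, b 0 z * e 0 z ∂P = 0 := by
    have := covariance_eq_sub hb2 he2
    rw [hcov, he0, mul_zero, sub_zero] at this
    exact this.symm
  have hei : Integrable (e 0) P := he2.integrable (by norm_num)
  have hfst : Measurable fun p : ℝ × ℝ => Real.log |p.1| := by fun_prop
  obtain ⟨hne, hli, hl0⟩ := hlog
  have hne' : ∀ᵐ p ∂ν, p.1 ≠ 0 :=
    (ae_map_iff hξ.aemeasurable (measurableSet_eq_fun measurable_fst measurable_const).compl).2 hne
  obtain ⟨π, hπ, hst⟩ := exists_isStationary (ν := ν) hne' m (fun f hf hCf => by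
    obtain ⟨C, hC⟩ := hCf
    have hTm : Measurable fun y => ∫ p, f (p.1 * y + p.2) ∂ν :=
      measurable_integral_affine hf.measurable
    have hTb : ∀ y, |∫ p, f (p.1 * y + p.2) ∂ν| ≤ C := fun y => by
      have := norm_integral_le_of_norm_le_const (μ := ν) (f := fun p => f (p.1 * y + p.2)) (C := C)
        (Eventually.of_forall fun p => hC _)
      simpa using this
    -- By the Markov property the sum telescopes, so for bounded `f` the averaged laws are invariant
    -- up to `O(1 / n)`.
    have heq : ∀ n, ∫ y, (∫ p, f (p.1 * y + p.2) ∂ν) ∂(m n) - ∫ y, f y ∂(m n)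
        = 1 / ((n : ℝ) + 1) * (∫ z, f (X (n + 1) z) ∂P - ∫ z, f (X 0 z) ∂P) := by
      intro n
      rw [hint _ hTm ⟨C, hTb⟩, hint _ hf.measurable ⟨C, hC⟩, ← mul_sub, ← Finset.sum_sub_distrib,
        ← Finset.sum_range_sub (fun k => ∫ z, f (X k z) ∂P)]
      congr 1
      refine Finset.sum_congr rfl fun k _ => ?_
      rw [integral_process_succ hb he hind hid hf.measurable hC k]
    have hEb : ∀ k, |∫ z, f (X k z) ∂P| ≤ C := fun k => by
      have := norm_integral_le_of_norm_le_const (μ := P) (f := fun z => f (X k z)) (C := C)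
        (Eventually.of_forall fun p => hC _)
      simpa using this
    have hz : Tendsto (fun n : ℕ => 1 / ((n : ℝ) + 1) * (C + C)) atTop (𝓝 0) := by
      simpa using (tendsto_one_div_add_atTop_nhds_zero_nat (𝕜 := ℝ)).mul_const (C + C)
    refine squeeze_zero_norm (fun n => ?_) hz
    rw [heq, Real.norm_eq_abs, abs_mul, abs_of_pos (by positivity : (0 : ℝ) < 1 / ((n : ℝ) + 1))]
    exact mul_le_mul_of_nonneg_left ((abs_sub _ _).trans (add_le_add (hEb _) (hEb _)))
      (by positivity)) hr hr0 (by
    simpa only [hint r hr.measurable ⟨C, hC⟩] using hnot)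
  refine not_isStationary (ν := ν) (π := π) (σsq := σsq) hne'
    ((integrable_map_measure hfst.aestronglyMeasurable hξ.aemeasurable).2 hli) ?_ ?_ ?_ ?_ ?_ ?_
    hσ hst
  · rw [hν, stepLaw, integral_map hξ.aemeasurable hfst.aestronglyMeasurable]
    exact hl0
  · exact (memLp_map_measure_iff measurable_fst.aestronglyMeasurable hξ.aemeasurable).2
      ((memLp_const φ).add hb2)
  · exact (memLp_map_measure_iff measurable_snd.aestronglyMeasurable hξ.aemeasurable).2 he2
  · rw [hν, stepLaw, integral_map hξ.aemeasurable measurable_snd.aestronglyMeasurable]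
    exact he0
  · rw [hν, stepLaw, integral_map hξ.aemeasurable (by fun_prop)]
    simp only [add_mul]
    have hbei : Integrable (fun z => b 0 z * e 0 z) P := hb2.integrable_mul he2
    rw [integral_add (hei.const_mul φ) hbei, integral_const_mul, he0, hbe]
    simp
  · rw [hν, stepLaw, integral_map hξ.aemeasurable (by fun_prop)]
    exact hesq

end Recursion

/-! ### Pathwise estimates of the likelihood -/

theorem abs_log_sub_log_le {p q m : ℝ} (hm : 0 < m) (hp : m ≤ p) (hq : m ≤ q) :
    |Real.log p - Real.log q| ≤ |p - q| / m := by
  have key : ∀ p q : ℝ, m ≤ p → m ≤ q → Real.log p - Real.log q ≤ |p - q| / m := by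
    intro p q hp hq
    have hp0 := hm.trans_le hp
    have hq0 := hm.trans_le hq
    rw [← Real.log_div hp0.ne' hq0.ne']
    calc Real.log (p / q) ≤ p / q - 1 := Real.log_le_sub_one_of_pos (by positivity)
      _ = (p - q) / q := by field_simp
      _ ≤ |p - q| / q := by gcongr; exact le_abs_self _
      _ ≤ |p - q| / m := by gcongr
  rw [abs_le]
  have h1 := key p q hp hq
  have h2 := key q p hq hp
  rw [abs_sub_comm q p] at h2
  exact ⟨by linarith, h1⟩

/-- The weight that controls the dependence of the likelihood terms on the state. -/
def decayWeight (X : ℝ) : ℝ := (1 + |X|) / (1 + X ^ 2)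

theorem decayWeight_nonneg (X : ℝ) : 0 ≤ decayWeight X := by
  unfold decayWeight; positivity

theorem decayWeight_le_two (X : ℝ) : decayWeight X ≤ 2 := by
  unfold decayWeight
  rw [div_le_iff₀ (by positivity), ← sq_abs X]
  nlinarith [sq_nonneg (|X| - 1), sq_nonneg |X|]

theorem continuous_decayWeight : Continuous decayWeight := by
  unfold decayWeight
  exact (by fun_prop : Continuous fun X : ℝ => 1 + |X|).div (by fun_prop) fun X => by positivity

theorem tendsto_decayWeight : Tendsto decayWeight (cocompact ℝ) (𝓝 0) := by
  have h1 : Tendsto (fun X : ℝ => 2 * |X|⁻¹) (cocompact ℝ) (𝓝 0) := by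
    simpa using (tendsto_inv_atTop_zero.comp (tendsto_norm_cocompact_atTop (E := ℝ))).const_mul 2
  refine squeeze_zero' (Eventually.of_forall decayWeight_nonneg) ?_ h1
  filter_upwards [(tendsto_norm_cocompact_atTop (E := ℝ)).eventually_ge_atTop 1] with X hX
  rw [Real.norm_eq_abs] at hX
  have h0 : 0 < |X| := by linarith
  unfold decayWeight
  rw [← div_eq_mul_inv, div_le_div_iff₀ (by positivity) h0, ← sq_abs X]
  nlinarith

/-- Over the common denominator the `X²` terms cancel. The numerator is then affine in `X`, while
the denominator is at least `κ (1 + X²)`. -/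
theorem abs_quadratic_sub_le {κ K c e X x y : ℝ} (hκ : 0 < κ) (hx : κ ≤ x) (hy : κ ≤ y)
    (hyK : y ≤ K) :
    |(c * X + e) ^ 2 / (x * X ^ 2 + y) - c ^ 2 / x|
      ≤ (1 + K / κ) / κ * (c ^ 2 + e ^ 2) * decayWeight X := by
  have hx0 : 0 < x := hκ.trans_le hx
  have hy0 : 0 < y := hκ.trans_le hy
  have hX2 := sq_nonneg X
  have hden : κ * (1 + X ^ 2) ≤ x * X ^ 2 + y := by nlinarith
  have hpos : 0 < κ * (1 + X ^ 2) := by positivity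
  have hd : 0 < x * X ^ 2 + y := hpos.trans_le hden
  have heq : (c * X + e) ^ 2 / (x * X ^ 2 + y) - c ^ 2 / x
      = (2 * c * e * X + e ^ 2 - c ^ 2 * (y / x)) / (x * X ^ 2 + y) := by
    field_simp
    ring
  have hK0 : 0 ≤ K := hy0.le.trans hyK
  have hyx : y / x ≤ K / κ := by gcongr
  have hyx0 : 0 ≤ y / x := by positivity
  have hnum : |2 * c * e * X + e ^ 2 - c ^ 2 * (y / x)|
      ≤ (1 + K / κ) * (c ^ 2 + e ^ 2) * (1 + |X|) := by
    have h1 : |2 * c * e * X| ≤ (c ^ 2 + e ^ 2) * |X| := by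
      rw [abs_mul]
      refine mul_le_mul_of_nonneg_right ?_ (abs_nonneg _)
      rw [abs_le]
      constructor <;> nlinarith [sq_nonneg (c - e), sq_nonneg (c + e)]
    have h2 : |2 * c * e * X + e ^ 2 - c ^ 2 * (y / x)|
        ≤ |2 * c * e * X| + e ^ 2 + c ^ 2 * (y / x) := by
      refine (abs_sub _ _).trans ?_
      rw [abs_of_nonneg (by positivity : 0 ≤ c ^ 2 * (y / x))]
      have := abs_add_le (2 * c * e * X) (e ^ 2)
      rw [abs_of_nonneg (sq_nonneg e)] at this
      linarith
    have h3 : c ^ 2 * (y / x) ≤ c ^ 2 * (K / κ) := by gcongr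
    have hK : 0 ≤ K / κ := hyx0.trans hyx
    have h4 : 0 ≤ (c ^ 2 + e ^ 2) * |X| * (K / κ) := by positivity
    have h5 : 0 ≤ e ^ 2 * (K / κ) := by positivity
    nlinarith [sq_nonneg c, sq_nonneg e]
  have hn0 : 0 ≤ (1 + K / κ) * (c ^ 2 + e ^ 2) * (1 + |X|) := (abs_nonneg _).trans hnum
  rw [heq, abs_div, abs_of_pos hd]
  calc _ ≤ ((1 + K / κ) * (c ^ 2 + e ^ 2) * (1 + |X|)) / (κ * (1 + X ^ 2)) := by gcongr
    _ = _ := by unfold decayWeight; field_simp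

/-- After cross-multiplication by `w` and `x` the two arguments differ by `w y - x v`, free of `X`,
and both are at least `κ² (1 + X²)`; the Lipschitz bound for the logarithm applies. -/
theorem abs_log_quadratic_sub_le {κ K X x y w v : ℝ} (hκ : 0 < κ) (hx : κ ≤ x) (hy : κ ≤ y)
    (hw : κ ≤ w) (hv : κ ≤ v) (hxK : x ≤ K) (hyK : y ≤ K) (hwK : w ≤ K) (hvK : v ≤ K) :
    |Real.log (x * X ^ 2 + y) - Real.log (w * X ^ 2 + v) - Real.log (x / w)|
      ≤ K ^ 2 / κ ^ 2 * decayWeight X := by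
  have hx0 : 0 < x := hκ.trans_le hx
  have hy0 : 0 < y := hκ.trans_le hy
  have hw0 : 0 < w := hκ.trans_le hw
  have hv0 : 0 < v := hκ.trans_le hv
  have hX2 := sq_nonneg X
  have hp : κ ^ 2 * (1 + X ^ 2) ≤ w * (x * X ^ 2 + y) := by
    have : κ * (1 + X ^ 2) ≤ x * X ^ 2 + y := by nlinarith
    calc _ = κ * (κ * (1 + X ^ 2)) := by ring
      _ ≤ _ := by gcongr
  have hq : κ ^ 2 * (1 + X ^ 2) ≤ x * (w * X ^ 2 + v) := by
    have : κ * (1 + X ^ 2) ≤ w * X ^ 2 + v := by nlinarith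
    calc _ = κ * (κ * (1 + X ^ 2)) := by ring
      _ ≤ _ := by gcongr
  have heq : Real.log (x * X ^ 2 + y) - Real.log (w * X ^ 2 + v) - Real.log (x / w)
      = Real.log (w * (x * X ^ 2 + y)) - Real.log (x * (w * X ^ 2 + v)) := by
    rw [Real.log_mul hw0.ne' (by positivity), Real.log_mul hx0.ne' (by positivity),
      Real.log_div hx0.ne' hw0.ne']
    ring
  rw [heq]
  refine (abs_log_sub_log_le (by positivity) hp hq).trans ?_
  have hdiff : |w * (x * X ^ 2 + y) - x * (w * X ^ 2 + v)| ≤ K ^ 2 * (1 + |X|) := by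
    have h1 : w * (x * X ^ 2 + y) - x * (w * X ^ 2 + v) = w * y - x * v := by ring
    have h2 : w * y ≤ K ^ 2 := by rw [sq]; gcongr; linarith
    have h3 : x * v ≤ K ^ 2 := by rw [sq]; gcongr; linarith
    have h4 : 0 < w * y := by positivity
    have h5 : 0 < x * v := by positivity
    have h6 : |w * y - x * v| ≤ K ^ 2 := by rw [abs_le]; constructor <;> linarith
    rw [h1]
    nlinarith [abs_nonneg X, sq_nonneg K]
  calc _ ≤ (K ^ 2 * (1 + |X|)) / (κ ^ 2 * (1 + X ^ 2)) := by gcongr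
    _ = _ := by unfold decayWeight; field_simp

/-- A centered likelihood term is its state-independent leading part up to a decaying error. -/
theorem abs_logLikTerm_sub_le {κ K φ w v s x y b e X : ℝ} (hκ : 0 < κ) (hx : κ ≤ x) (hy : κ ≤ y)
    (hw : κ ≤ w) (hv : κ ≤ v) (hxK : x ≤ K) (hyK : y ≤ K) (hwK : w ≤ K) (hvK : v ≤ K)
    (hs : |φ - s| ≤ K) {Y : ℕ → ℝ} {k : ℕ} (hX : Y k = X) (hY : Y (k + 1) = (φ + b) * X + e) :
    |logLikTerm Y (k + 1) (s, x, y) - logLikTerm Y (k + 1) (φ, w, v) - limitFun φ w s x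
        + 1 / 2 * (2 * (φ - s) / x * b + (1 / x - 1 / w) * (b ^ 2 - w))|
      ≤ (K ^ 2 / κ ^ 2 + (1 + K / κ) / κ * (2 * K ^ 2 + 3)) * (1 + b ^ 2 + e ^ 2)
        * decayWeight X := by
  have hx0 : 0 < x := hκ.trans_le hx
  have hw0 : 0 < w := hκ.trans_le hw
  have hK0 : 0 ≤ K := hx0.le.trans hxK
  have h1 := abs_log_quadratic_sub_le (X := X) hκ hx hy hw hv hxK hyK hwK hvK
  have h2 := abs_quadratic_sub_le (c := φ - s + b) (e := e) (X := X) hκ hx hy hyK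
  have h3 := abs_quadratic_sub_le (c := b) (e := e) (X := X) hκ hw hv hvK
  have hr := decayWeight_nonneg X
  set L := Real.log (x * X ^ 2 + y) - Real.log (w * X ^ 2 + v) - Real.log (x / w) with hL
  set Q := ((φ - s + b) * X + e) ^ 2 / (x * X ^ 2 + y) - (φ - s + b) ^ 2 / x with hQ
  set R := (b * X + e) ^ 2 / (w * X ^ 2 + v) - b ^ 2 / w with hR
  -- The leading parts are `(φ - s + b)² / x` and `b² / w`. Expanding the square and writing `b² =
  -- (b² - w) + w` produces the limit function and the two centered corrections.
  have heq : logLikTerm Y (k + 1) (s, x, y) - logLikTerm Y (k + 1) (φ, w, v) - limitFun φ w s x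
        + 1 / 2 * (2 * (φ - s) / x * b + (1 / x - 1 / w) * (b ^ 2 - w))
      = -(1 / 2) * (L + Q - R) := by
    have e1 : (φ + b) * X + e - s * X = (φ - s + b) * X + e := by ring
    have e2 : (φ + b) * X + e - φ * X = b * X + e := by ring
    simp only [logLikTerm, limitFun, Nat.add_sub_cancel, hX, hY, e1, e2]
    rw [hL, hQ, hR, Real.log_div hw0.ne' hx0.ne', Real.log_div hx0.ne' hw0.ne']
    field_simp
    ring
  have hc : (φ - s + b) ^ 2 ≤ 2 * K ^ 2 + 2 * b ^ 2 := by
    have : (φ - s) ^ 2 ≤ K ^ 2 := by rw [← sq_abs (φ - s)]; gcongr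
    nlinarith [sq_nonneg (φ - s - b)]
  set a := (1 + K / κ) / κ with ha
  have ha0 : 0 ≤ a := by positivity
  have hm0 : 0 ≤ K ^ 2 / κ ^ 2 := by positivity
  have h2' : |Q| ≤ a * (2 * K ^ 2 + 2 * b ^ 2 + e ^ 2) * decayWeight X := by
    refine h2.trans ?_
    gcongr
  have habs : |L + Q - R| ≤ |L| + |Q| + |R| :=
    (abs_sub _ _).trans (by linarith [abs_add_le L Q])
  rw [heq, abs_mul, show |(-(1 / 2) : ℝ)| = 1 / 2 by norm_num [abs_of_pos]]
  have hsum : |L + Q - R| ≤ (K ^ 2 / κ ^ 2 + a * (2 * K ^ 2 + 2 * b ^ 2 + e ^ 2)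
      + a * (b ^ 2 + e ^ 2)) * decayWeight X := by
    calc _ ≤ _ := habs
      _ ≤ _ := add_le_add (add_le_add h1 h2') h3
      _ = _ := by ring
  have hfin : K ^ 2 / κ ^ 2 + a * (2 * K ^ 2 + 2 * b ^ 2 + e ^ 2) + a * (b ^ 2 + e ^ 2)
      ≤ (K ^ 2 / κ ^ 2 + a * (2 * K ^ 2 + 3)) * (1 + b ^ 2 + e ^ 2) := by
    have hbe : 0 ≤ b ^ 2 + e ^ 2 := by positivity
    have i1 : K ^ 2 / κ ^ 2 ≤ K ^ 2 / κ ^ 2 * (1 + b ^ 2 + e ^ 2) :=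
      le_mul_of_one_le_right hm0 (by linarith)
    have i2 : a * (2 * K ^ 2 + 2 * b ^ 2 + e ^ 2) + a * (b ^ 2 + e ^ 2)
        ≤ a * ((2 * K ^ 2 + 3) * (1 + b ^ 2 + e ^ 2)) := by
      rw [← mul_add]
      refine mul_le_mul_of_nonneg_left ?_ ha0
      linarith [sq_nonneg K, mul_nonneg (sq_nonneg K) hbe, sq_nonneg b, sq_nonneg e]
    rw [add_mul, mul_assoc a, add_assoc]
    exact add_le_add i1 i2
  have := hsum.trans (mul_le_mul_of_nonneg_right hfin hr)
  linarith [abs_nonneg (L + Q - R)]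

/-- The normalized centered likelihood is uniformly controlled on a parameter box by three time
averages. -/
theorem exists_abs_logLik_sub_le (φ : ℝ) {w v : ℝ} (hw : 0 < w) (hv : 0 < v)
    (sl su xl xu yl yu : ℝ) (hxl : 0 < xl) (hyl : 0 < yl) :
    ∃ C : ℝ, ∀ (Y b e : ℕ → ℝ),
      (∀ k, Y (k + 1) = (φ + b (k + 1)) * Y k + e (k + 1)) →
      ∀ n : ℕ, 0 < n → ∀ u ∈ paramBox sl su xl xu yl yu,
        |1 / (n : ℝ) * (logLik Y n u - logLik Y n (φ, w, v)) - limitFun φ w u.1 u.2.1|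
          ≤ C * (1 / (n : ℝ) * ∑ k ∈ Finset.range n,
                (1 + b (k + 1) ^ 2 + e (k + 1) ^ 2) * decayWeight (Y k)
              + |(n : ℝ)⁻¹ * ∑ k ∈ Finset.range n, b (k + 1)|
              + |(n : ℝ)⁻¹ * (∑ k ∈ Finset.range n, b (k + 1) ^ 2) - w|) := by
  -- A common lower bound for the four variance parameters; `K` below bounds them and `|φ - s|` from
  -- above. The resulting constant depends on the box only, not on the point `u`.
  set κ := min (min xl yl) (min w v) with hκdef
  have hκ : 0 < κ := lt_min (lt_min hxl hyl) (lt_min hw hv)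
  set K := |xu| + |yu| + w + v + |φ - sl| + |φ - su| with hK
  have n1 := abs_nonneg xu
  have n2 := abs_nonneg yu
  have n3 := abs_nonneg (φ - sl)
  have n4 := abs_nonneg (φ - su)
  have hK0 : 0 ≤ K := by positivity
  set C0 := K ^ 2 / κ ^ 2 + (1 + K / κ) / κ * (2 * K ^ 2 + 3) with hC0
  have hC00 : 0 ≤ C0 := by positivity
  refine ⟨C0 + K / κ + 1 / κ, fun Y b e hY n hn u hu => ?_⟩
  obtain ⟨s, x, y⟩ := u
  obtain ⟨⟨hs1, hs2⟩, ⟨hx1, hx2⟩, hy1, hy2⟩ := hu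
  simp only at hs1 hs2 hx1 hx2 hy1 hy2 ⊢
  have hκx : κ ≤ x := ((min_le_left _ _).trans (min_le_left _ _)).trans hx1
  have hκy : κ ≤ y := ((min_le_left _ _).trans (min_le_right _ _)).trans hy1
  have hκw : κ ≤ w := (min_le_right _ _).trans (min_le_left _ _)
  have hκv : κ ≤ v := (min_le_right _ _).trans (min_le_right _ _)
  have hx0 : 0 < x := hκ.trans_le hκx
  have hs : |φ - s| ≤ K := by
    rw [abs_le]
    constructor
    · linarith [neg_abs_le (φ - su)]
    · linarith [le_abs_self (φ - sl)]
  have hterm := fun k => abs_logLikTerm_sub_le (s := s) (b := b (k + 1)) (e := e (k + 1)) hκ hκx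
    hκy hκw hκv
    (by linarith [le_abs_self xu] : x ≤ K) (by linarith [le_abs_self yu] : y ≤ K)
    (by linarith : w ≤ K) (by linarith : v ≤ K) hs (Y := Y) (k := k) rfl (hY k)
  have hn0 : (0 : ℝ) < n := Nat.cast_pos.2 hn
  set S := ∑ k ∈ Finset.range n, (1 + b (k + 1) ^ 2 + e (k + 1) ^ 2) * decayWeight (Y k) with hS
  set B := ∑ k ∈ Finset.range n, b (k + 1) with hB
  set B2 := ∑ k ∈ Finset.range n, b (k + 1) ^ 2 with hB2
  have hlik : ∀ u, logLik Y n u = ∑ k ∈ Finset.range n, logLikTerm Y (k + 1) u := by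
    intro u
    rw [logLik, Finset.range_eq_Ico, Finset.sum_Ico_add' (fun k => logLikTerm Y k u) 0 n 1]
    rfl
  have hsum : |logLik Y n (s, x, y) - logLik Y n (φ, w, v) - n * limitFun φ w s x
      + 1 / 2 * (2 * (φ - s) / x * B + (1 / x - 1 / w) * (B2 - n * w))| ≤ C0 * S := by
    have h1 : logLik Y n (s, x, y) - logLik Y n (φ, w, v) - n * limitFun φ w s x
        + 1 / 2 * (2 * (φ - s) / x * B + (1 / x - 1 / w) * (B2 - n * w))
        = ∑ k ∈ Finset.range n, (logLikTerm Y (k + 1) (s, x, y) - logLikTerm Y (k + 1) (φ, w, v)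
          - limitFun φ w s x + 1 / 2 * (2 * (φ - s) / x * b (k + 1)
            + (1 / x - 1 / w) * (b (k + 1) ^ 2 - w))) := by
      rw [hlik, hlik, hB, hB2]
      simp only [Finset.sum_add_distrib, Finset.sum_sub_distrib, ← Finset.mul_sum, Finset.sum_const,
        Finset.card_range, nsmul_eq_mul]
    rw [h1, hS, Finset.mul_sum]
    refine (Finset.abs_sum_le_sum_abs _ _).trans (Finset.sum_le_sum fun k _ => ?_)
    rw [← mul_assoc]
    exact hterm k
  have hcoef1 : |(φ - s) / x| ≤ K / κ := by
    rw [abs_div, abs_of_pos hx0]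
    gcongr
  have hcoef2 : |1 / 2 * (1 / x - 1 / w)| ≤ 1 / κ := by
    have i1 : 1 / x ≤ 1 / κ := by gcongr
    have i2 : 1 / w ≤ 1 / κ := by gcongr
    have i3 : 0 < 1 / x := by positivity
    have i4 : 0 < 1 / w := by positivity
    rw [abs_le]
    constructor <;> linarith
  set T := logLik Y n (s, x, y) - logLik Y n (φ, w, v) - n * limitFun φ w s x with hT
  have hLHS : 1 / (n : ℝ) * (logLik Y n (s, x, y) - logLik Y n (φ, w, v)) - limitFun φ w s x
      = (n : ℝ)⁻¹ * (T + 1 / 2 * (2 * (φ - s) / x * B + (1 / x - 1 / w) * (B2 - n * w)))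
        - (φ - s) / x * ((n : ℝ)⁻¹ * B) - 1 / 2 * (1 / x - 1 / w) * ((n : ℝ)⁻¹ * B2 - w) := by
    rw [hT]
    field_simp
    ring
  rw [hLHS]
  have hA : |(n : ℝ)⁻¹ * (T + 1 / 2 * (2 * (φ - s) / x * B + (1 / x - 1 / w) * (B2 - n * w)))|
      ≤ C0 * (1 / (n : ℝ) * S) := by
    rw [abs_mul, abs_of_pos (inv_pos.2 hn0)]
    calc _ ≤ (n : ℝ)⁻¹ * (C0 * S) := by gcongr
      _ = _ := by ring
  have hS0 : 0 ≤ 1 / (n : ℝ) * S := by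
    refine mul_nonneg (by positivity) (Finset.sum_nonneg fun k _ => ?_)
    exact mul_nonneg (by positivity) (decayWeight_nonneg _)
  have hBa : |(φ - s) / x * ((n : ℝ)⁻¹ * B)| ≤ K / κ * |(n : ℝ)⁻¹ * B| := by
    rw [abs_mul]; gcongr
  have hB2a : |1 / 2 * (1 / x - 1 / w) * ((n : ℝ)⁻¹ * B2 - w)| ≤ 1 / κ * |(n : ℝ)⁻¹ * B2 - w| := by
    rw [abs_mul]; gcongr
  have hKκ : 0 ≤ K / κ := by positivity
  have hκ1 : 0 ≤ 1 / κ := by positivity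
  refine (abs_sub _ _).trans ((add_le_add ((abs_sub _ _).trans (add_le_add hA hBa)) hB2a).trans ?_)
  have p1 := abs_nonneg ((n : ℝ)⁻¹ * B)
  have p2 := abs_nonneg ((n : ℝ)⁻¹ * B2 - w)
  linarith [mul_nonneg hC00 p1, mul_nonneg hC00 p2, mul_nonneg hKκ hS0, mul_nonneg hKκ p2,
    mul_nonneg hκ1 hS0, mul_nonneg hκ1 p1]

/-! ### Convergence in probability -/

/-- Markov's inequality for the dominating variable. The event is enlarged first, so the supremum
need not be measurable; the index `n = 0` is irrelevant in the limit. -/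
theorem UniformlyTendstoZeroInProb.of_bound {Ω U : Type*} [MeasurableSpace Ω] {P : Measure Ω}
    {Γ : Set U} {F : ℕ → Ω → U → ℝ} {C : ℝ} {W : ℕ → Ω → ℝ}
    (hF : ∀ n, 0 < n → ∀ z, ∀ u ∈ Γ, |F n z u| ≤ C * W n z) (hW0 : ∀ n z, 0 ≤ W n z)
    (hWi : ∀ n, Integrable (W n) P) (hW : Tendsto (fun n => ∫ z, W n z ∂P) atTop (𝓝 0)) :
    UniformlyTendstoZeroInProb P Γ F := by
  intro ε hε
  have hε' : ENNReal.ofReal ε ≠ 0 := by simpa using hε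
  have hlim : Tendsto (fun n => ENNReal.ofReal (|C| * ∫ z, W n z ∂P) / ENNReal.ofReal ε) atTop
      (𝓝 0) := by
    have h1 : Tendsto (fun n => ENNReal.ofReal (|C| * ∫ z, W n z ∂P)) atTop (𝓝 0) := by
      simpa using ENNReal.tendsto_ofReal (hW.const_mul |C|)
    simpa using ENNReal.Tendsto.div_const h1 (Or.inr hε')
  refine tendsto_of_tendsto_of_tendsto_of_le_of_le' tendsto_const_nhds hlim
    (Eventually.of_forall fun _ => zero_le) ?_
  filter_upwards [eventually_gt_atTop 0] with n hn
  have hsub : {z | ENNReal.ofReal ε < ⨆ u ∈ Γ, ENNReal.ofReal |F n z u|}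
      ⊆ {z | ENNReal.ofReal ε ≤ ENNReal.ofReal (|C| * W n z)} := by
    intro z hz
    refine hz.le.trans (iSup₂_le fun u hu => ENNReal.ofReal_le_ofReal ?_)
    exact (hF n hn z u hu).trans (mul_le_mul_of_nonneg_right (le_abs_self C) (hW0 n z))
  refine (measure_mono hsub).trans ((meas_ge_le_lintegral_div
    ((hWi n).const_mul |C|).aestronglyMeasurable.aemeasurable.ennreal_ofReal hε'
    ENNReal.ofReal_ne_top).trans (le_of_eq ?_))
  rw [← ofReal_integral_eq_lintegral_ofReal ((hWi n).const_mul |C|)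
    (Eventually.of_forall fun z => mul_nonneg (abs_nonneg _) (hW0 n z)), integral_const_mul]

/-- The `L¹` law of large numbers for a sequence shifted by one step. -/
theorem tendsto_integral_abs_average_sub {Ω : Type*} [MeasurableSpace Ω] {P : Measure Ω}
    [IsProbabilityMeasure P] {Y : ℕ → Ω → ℝ} (hY : Integrable (Y 0) P) (hind : iIndepFun Y P)
    (hid : ∀ k, IdentDistrib (Y k) (Y 0) P P) :
    Tendsto (fun n : ℕ => ∫ z, |(n : ℝ)⁻¹ * (∑ k ∈ Finset.range n, Y (k + 1) z) - ∫ z, Y 0 z ∂P| ∂P)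
      atTop (𝓝 0) := by
  have hY1 : ∀ k, Integrable (Y k) P := fun k => (hid k).integrable_iff.2 hY
  have h := strong_law_Lp (μ := P) (p := 1) le_rfl (by simp) (fun k => Y (k + 1))
    (memLp_one_iff_integrable.2 (hY1 1))
    (fun i j hij => hind.indepFun (by simpa using hij)) (fun k => (hid (k + 1)).trans (hid 1).symm)
  have h2 : ∀ n : ℕ, ∫ z, |(n : ℝ)⁻¹ * (∑ k ∈ Finset.range n, Y (k + 1) z) - ∫ z, Y 0 z ∂P| ∂P
      = (eLpNorm (fun z => (n : ℝ)⁻¹ • (∑ k ∈ Finset.range n, Y (k + 1) z)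
        - ∫ z, Y 1 z ∂P) 1 P).toReal := by
    intro n
    have hm : AEStronglyMeasurable (fun z => (n : ℝ)⁻¹ • (∑ k ∈ Finset.range n, Y (k + 1) z)
        - ∫ z, Y 1 z ∂P) P :=
      (((integrable_finsetSum _ fun k _ => hY1 (k + 1)).const_mul _).sub
        (integrable_const _)).aestronglyMeasurable
    rw [eLpNorm_one_eq_lintegral_enorm, ← integral_norm_eq_lintegral_enorm hm, (hid 1).integral_eq]
    rfl
  simp_rw [h2]
  simpa [Function.comp_def] using (ENNReal.tendsto_toReal ENNReal.zero_ne_top).comp h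

end RCA

end

theorem lemma4p2 {Ω : Type*} [MeasurableSpace Ω] (P : Measure Ω) [IsProbabilityMeasure P]
    (b e : ℕ → Ω → ℝ) (φ ωsq σsq x₀ : ℝ)
    -- the vectors (b_k, e_k) are independent and identically distributed
    (hb_meas : ∀ k, Measurable (b k)) (he_meas : ∀ k, Measurable (e k))
    (h_indep : iIndepFun (fun k z => (b k z, e k z)) P)
    (h_ident : ∀ k, IdentDistrib (fun z => (b k z, e k z)) (fun z => (b 0 z, e 0 z)) P P)
    -- E log⁺ |e_0| and E log⁺ |φ + b_0| are finite
    (he_log : Integrable (fun z => Real.posLog |e 0 z|) P)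
    (hb_log : Integrable (fun z => Real.posLog |φ + b 0 z|) P)
    -- E b_0 = 0 and E b_0² = ω² > 0
    (hb_L2 : MemLp (b 0) 2 P) (hb_mean : ∫ z, b 0 z ∂P = 0)
    (hb_sq : ∫ z, b 0 z ^ 2 ∂P = ωsq) (hω : 0 < ωsq)
    -- E e_0 = 0 and E e_0² = σ² > 0
    (he_L2 : MemLp (e 0) 2 P) (he_mean : ∫ z, e 0 z ∂P = 0)
    (he_sq : ∫ z, e 0 z ^ 2 ∂P = σsq) (hσ : 0 < σsq)
    -- cov(b_0, e_0) = 0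
    (h_cov : cov[b 0, e 0; P] = 0)
    -- E log |φ + b_0| ≥ 0
    (h_log : RCA.LogMeanNonneg P (fun z => φ + b 0 z))
    -- the parameter box
    (sl su xl xu yl yu : ℝ) (hxl : 0 < xl) (hyl : 0 < yl) :
    -- uniform convergence in probability to the limit function
    RCA.UniformlyTendstoZeroInProb P (RCA.paramBox sl su xl xu yl yu)
      (fun n z u =>
        1 / (n : ℝ) * (RCA.logLik (fun k => RCA.process φ x₀ b e k z) n u
            - RCA.logLik (fun k => RCA.process φ x₀ b e k z) n (φ, ωsq, σsq))
          - RCA.limitFun φ ωsq u.1 u.2.1) ∧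
    -- in particular, the third parameter has no influence on the normalized likelihood in the limit
    RCA.UniformlyTendstoZeroInProb P (RCA.paramBox sl su xl xu yl yu ×ˢ Set.Icc yl yu)
      (fun n z w =>
        1 / (n : ℝ) * (RCA.logLik (fun k => RCA.process φ x₀ b e k z) n w.1
            - RCA.logLik (fun k => RCA.process φ x₀ b e k z) n (w.1.1, w.1.2.1, w.2))) := by
  obtain ⟨C, hbound⟩ :=
    RCA.exists_abs_logLik_sub_le φ hω hσ sl su xl xu yl yu hxl hyl
  set X := RCA.process φ x₀ b e with hX
  have hXm : ∀ k, Measurable (X k) := RCA.measurable_process hb_meas he_meas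
  have hbid : ∀ k, IdentDistrib (b k) (b 0) P P := fun k => (h_ident k).comp measurable_fst
  have heid : ∀ k, IdentDistrib (e k) (e 0) P P := fun k => (h_ident k).comp measurable_snd
  have hbL2 : ∀ k, MemLp (b k) 2 P := fun k => (hbid k).memLp_iff.2 hb_L2
  have heL2 : ∀ k, MemLp (e k) 2 P := fun k => (heid k).memLp_iff.2 he_L2
  have hbi : ∀ k, Integrable (b k) P := fun k => (hbL2 k).integrable (by norm_num)
  let A : ℕ → Ω → ℝ := fun n z => 1 / (n : ℝ) * ∑ k ∈ Finset.range n,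
    (1 + b (k + 1) z ^ 2 + e (k + 1) z ^ 2) * RCA.decayWeight (X k z)
  let B : ℕ → Ω → ℝ := fun n z => |(n : ℝ)⁻¹ * ∑ k ∈ Finset.range n, b (k + 1) z|
  let D : ℕ → Ω → ℝ := fun n z => |(n : ℝ)⁻¹ * (∑ k ∈ Finset.range n, b (k + 1) z ^ 2) - ωsq|
  have hgi : ∀ k, Integrable (fun z => 1 + b k z ^ 2 + e k z ^ 2) P := fun k =>
    ((integrable_const 1).add (hbL2 k).integrable_sq).add (heL2 k).integrable_sq
  have hAk : ∀ k, Integrable (fun z =>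
      (1 + b (k + 1) z ^ 2 + e (k + 1) z ^ 2) * RCA.decayWeight (X k z)) P := fun k =>
    (hgi (k + 1)).mul_bdd (c := 2)
      (RCA.continuous_decayWeight.measurable.comp (hXm k)).aestronglyMeasurable
      (Eventually.of_forall fun z => by
        rw [Real.norm_eq_abs, abs_of_nonneg (RCA.decayWeight_nonneg _)]
        exact RCA.decayWeight_le_two _)
  have hAi : ∀ n, Integrable (A n) P := fun n =>
    (integrable_finsetSum _ fun k _ => hAk k).const_mul _
  have hBi : ∀ n, Integrable (B n) P := fun n =>
    ((integrable_finsetSum _ fun k _ => hbi (k + 1)).const_mul _).abs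
  have hDi : ∀ n, Integrable (D n) P := fun n =>
    (((integrable_finsetSum _ fun k _ => (hbL2 (k + 1)).integrable_sq).const_mul _).sub
      (integrable_const _)).abs
  have hA0 : ∀ n z, 0 ≤ A n z := fun n z =>
    mul_nonneg (by positivity) (Finset.sum_nonneg fun k _ =>
      mul_nonneg (by positivity) (RCA.decayWeight_nonneg _))
  have hW0 : ∀ n z, 0 ≤ A n z + B n z + D n z := fun n z =>
    add_nonneg (add_nonneg (hA0 n z) (abs_nonneg _)) (abs_nonneg _)
  -- Independence pulls the fixed moment `E (1 + b₀² + e₀²)` out of each summand, leaving the Cesàro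
  -- means of the decaying weight.
  have hAlim : Tendsto (fun n => ∫ z, A n z ∂P) atTop (𝓝 0) := by
    rw [← tendsto_add_atTop_iff_nat 1]
    have h1 := (RCA.tendsto_cesaro_zero (x₀ := x₀) hb_meas he_meas h_indep h_ident hb_L2 he_L2
      he_mean he_sq hσ h_cov h_log RCA.continuous_decayWeight RCA.tendsto_decayWeight).const_mul
        (∫ z, (1 + b 0 z ^ 2 + e 0 z ^ 2) ∂P)
    rw [mul_zero] at h1
    refine h1.congr fun n => ?_
    simp only [A]
    rw [integral_const_mul, integral_finsetSum _ fun k _ => hAk k]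
    have h2 : ∀ k, ∫ z, (1 + b (k + 1) z ^ 2 + e (k + 1) z ^ 2) * RCA.decayWeight (X k z) ∂P
        = (∫ z, (1 + b 0 z ^ 2 + e 0 z ^ 2) ∂P) * ∫ z, RCA.decayWeight (X k z) ∂P := fun k =>
      RCA.integral_innovation_mul hb_meas he_meas h_indep h_ident
        (g := fun p : ℝ × ℝ => 1 + p.1 ^ 2 + p.2 ^ 2) (by fun_prop)
        RCA.continuous_decayWeight.measurable k
    simp only [h2, ← Finset.mul_sum]
    push_cast
    ring
  have hBlim : Tendsto (fun n => ∫ z, B n z ∂P) atTop (𝓝 0) := by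
    have h1 := RCA.tendsto_integral_abs_average_sub (Y := b) (hbi 0)
      (h_indep.comp (fun _ => Prod.fst) fun _ => measurable_fst) hbid
    simpa only [hb_mean, sub_zero] using h1
  have hDlim : Tendsto (fun n => ∫ z, D n z ∂P) atTop (𝓝 0) := by
    have h1 := RCA.tendsto_integral_abs_average_sub (Y := fun k z => b k z ^ 2)
      (hbL2 0).integrable_sq
      (h_indep.comp (fun _ (p : ℝ × ℝ) => p.1 ^ 2) fun _ => by fun_prop)
      (fun k => (hbid k).comp (u := fun x : ℝ => x ^ 2) (by fun_prop))
    simpa only [hb_sq] using h1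
  have hWi : ∀ n, Integrable (fun z => A n z + B n z + D n z) P := fun n =>
    ((hAi n).add (hBi n)).add (hDi n)
  have hW : Tendsto (fun n => ∫ z, (A n z + B n z + D n z) ∂P) atTop (𝓝 0) := by
    have h1 : ∀ n, ∫ z, (A n z + B n z + D n z) ∂P
        = ∫ z, A n z ∂P + ∫ z, B n z ∂P + ∫ z, D n z ∂P := fun n => by
      rw [integral_add (by exact (hAi n).add (hBi n)) (hDi n), integral_add (hAi n) (hBi n)]
    simp_rw [h1]
    simpa using (hAlim.add hBlim).add hDlim
  have hmain : ∀ n : ℕ, 0 < n → ∀ z, ∀ u ∈ RCA.paramBox sl su xl xu yl yu,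
      |1 / (n : ℝ) * (RCA.logLik (fun k => X k z) n u
            - RCA.logLik (fun k => X k z) n (φ, ωsq, σsq))
          - RCA.limitFun φ ωsq u.1 u.2.1| ≤ C * (A n z + B n z + D n z) := fun n hn z u hu =>
    hbound (fun k => X k z) (fun k => b k z) (fun k => e k z) (fun _ => rfl) n hn u hu
  -- The second claim compares `(s, x, y)` and `(s, x, y')` with the same limit, whence the factor
  -- `2`.
  refine ⟨RCA.UniformlyTendstoZeroInProb.of_bound hmain hW0 hWi hW,
    RCA.UniformlyTendstoZeroInProb.of_bound (C := 2 * C) ?_ hW0 hWi hW⟩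
  rintro n hn z ⟨⟨s, x, y⟩, y'⟩ ⟨hu, hy'⟩
  have h1 := hmain n hn z (s, x, y) hu
  have h2 := hmain n hn z (s, x, y') ⟨hu.1, hu.2.1, hy'⟩
  rw [abs_le] at h1 h2 ⊢
  simp only at h1 h2 ⊢
  constructor <;> linarith [h1.1, h1.2, h2.1, h2.2]
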